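/- **Setting.** Let $\mathcal X\subset\mathbb R^d$ and $\mathcal C\subset\mathbb R^{d'}$ be compact and convex, $\mathcal X$ of positive Lebesgue measure, and $\mathcal W=\mathcal X\times\mathcal C$. Let $\kappa$ be a Borel probability measure on $\mathcal C$ and $\varrho=\mathrm{Unif}(\mathcal X)\otimes\kappa$. Let $k$ be a continuous positive semidefinite kernel on $\mathcal W$ with $k(w,w)\le 1$, and let $\tau>0$. Suppose that $k$ has a Mercer decomposition with respect to $\varrho$, i.e. $k(w,w')=\sum_{j\ge1}\lambda_j\psi_j(w)\psi_j(w')$ for all $w,w'\in\mathcal W$ with $\lambda_1\ge\lambda_2\ge\dots\ge0$ and continuous functions $\psi_j$ that are orthonormal in $L_2(\varrho)$. Suppose also that $\lambda_j\le C_p j^{-\beta_p}$ and $\sup_{w\in\mathcal W}|\psi_j(w)|\le F$ for all $j\ge 1$, where $C_p,F>0$ and $\beta_p>1$. For points $a=(a_1,\dots,a_m)$ and $b=(b_1,\dots,b_n)$ in $\mathcal W$ write $\mathbf K_{a,b}=[k(a_i,b_j)]_{i,j}$ and $\mathbf k_a(w)=[k(a_i,w)]_i$. Let $$\gamma_T=\sup_{a\in\mathcal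 W^T}\tfrac12\log\det(\mathbf I_T+\tau^{-1}\mathbf K_{a,a}),\qquad K=\lceil T/\gamma_T\rceil$$ ($K=0$ in the trivial case $\gamma_T=0$). For an approximating set $\mathcal Z=(z_1,\dots,z_{TK})\in\mathcal W^{TK}$, data points $\mathbf W_T=(w_1,\dots,w_T)\in\mathcal W^T$ and rewards $\mathbf Y_T\in\mathbb R^T$ put $$\overline\mu_T(w)=\tfrac1\tau\Big(\mathbf k_{\mathbf W_T}(w)^\top\mathbf Y_T-\mathbf k_{\mathcal Z}(w)^\top(\mathbf K_{\mathcal Z,\mathcal Z}+K\tau\mathbf I)^{-1}\mathbf K_{\mathcal Z,\mathbf W_T}\mathbf Y_T\Big),$$ $$\overline\sigma^2(w)=\tfrac1\tau\Big(k(w,w)-\mathbf k_{\mathcal Z}(w)^\top(\mathbf K_{\mathcal Z,\mathcal Z}+K\tau\mathbf I)^{-1}\mathbf k_{\mathcal Z}(w)\Big),$$ so that $\overline\sigma^2$ depends only on $\mathcal Z$. A database is $\mathcal S_T=((c_1,y_1),\dots,(c_T,y_T),c_{T+1})$ with $c_i\in\mathcal C$ and $|y_i|<B$, where $B>0$. Two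 databases are $t$-neighbours ($1\le t\le T$) if they differ at most in $(c_t,y_t)$. Given query points $x_1,\dots,x_T\in\mathcal X$, which do not depend on the database, the data points of $\mathcal S_T$ are $w_i=(x_i,c_i)$. Let $\overline\mu_T$ and $\overline\mu_T'$ denote the estimators of $\mathcal S_T$ and $\mathcal S'_T$ with the same query points and the same $\mathcal Z$. **Claim.** 1. For all $B>0$, $T\ge1$, $1\le t\le T$, all query points $x_1,\dots,x_T\in\mathcal X$ and every $\mathcal Z\in\mathcal W^{TK}$, the following suprema are finite and $$\sup_{w\in\mathcal W}\ \sup_{\mathcal S_T,\mathcal S_T'\ t\text{-neighbours}}|\overline\mu_T(w)-\overline\mu_T'(w)|\le 2B\sup_{w\in\mathcal W}\overline\sigma^2(w).$$ 2. Let $\overline N_1(\delta)=\Big(\frac{\log(1/\delta)}{16C_pF^2}\Big)^{2\beta_p/(\beta_p-1)}$. There is a function $\overline N$ of $\delta$, determined by the setting above (the kernel with its constants, $\varrho$ and $\tau$), such that for all $\delta\in(0,1)$ and all $T>\max(\overline N_1(\delta/4),\overline N(\delta/4))$: if $z_1,\dots,z_{TK}$ are drawn i.i.d. from $\varrho$,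 then with probability at least $1-\delta$ $$\sup_{w\in\mathcal W}\overline\sigma^2(w)\le\frac{81F^2\gamma_T}{13\,T}.$$ -/

import Mathlib

open MeasureTheory Matrix

noncomputable section

namespace USCA

/-- The ambient space of (point, context) pairs `w = (x, c)`. -/
abbrev Pt (d d' : ℕ) := EuclideanSpace ℝ (Fin d) × EuclideanSpace ℝ (Fin d')

/-- `k` is a (real, symmetric, positive semidefinite) kernel on the set `W`. -/
def IsKernelOn {E : Type*} (k : E → E → ℝ) (W : Set E) : Prop :=
  (Matrix.of fun w w' : W => k w w').PosSemidef

/-- The sampling distribution `ϱ`: the point is uniform on `X` (normalised Lebesgue measure) and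
the context is drawn independently from `κ`. -/
def samplingLaw {d d' : ℕ} (X : Set (EuclideanSpace ℝ (Fin d)))
    (κ : Measure (EuclideanSpace ℝ (Fin d'))) : Measure (Pt d d') :=
  (ProbabilityTheory.cond volume X).prod κ

/-- `(lam, ψ)` is a Mercer eigensystem of `k` on `W` with respect to `ϱ`: the `ψ j` are continuous
on `W` and orthonormal in `L²(ϱ)`, the `lam j` are nonnegative and in descending order, and
`k w w' = ∑ j, lam j * ψ j w * ψ j w'` on `W`. The index `j : ℕ` starts at `0`. -/
structure IsMercerSystem {E : Type*} [TopologicalSpace E] [MeasurableSpace E]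
    (k : E → E → ℝ) (W : Set E) (ϱ : Measure E) (lam : ℕ → ℝ) (ψ : ℕ → E → ℝ) : Prop where
  continuousOn : ∀ j, ContinuousOn (ψ j) W
  orthonormal : ∀ i j, ∫ w, ψ i w * ψ j w ∂ϱ = if i = j then 1 else 0
  nonneg : ∀ j, 0 ≤ lam j
  antitone : Antitone lam
  hasSum : ∀ w ∈ W, ∀ w' ∈ W, HasSum (fun j => lam j * ψ j w * ψ j w') (k w w')

/-- The polynomial eigendecay condition with constants `Cp` and `βp`. Since our indices start at
`0`, the eigenvalue number `j` is `lam (j - 1)`. -/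
def PolynomialEigendecay (lam : ℕ → ℝ) (Cp βp : ℝ) : Prop :=
  ∀ j : ℕ, lam j ≤ Cp * ((j : ℝ) + 1) ^ (-βp)

/-- The matrix `[k (a i) (b j)]`. -/
def kernelMatrix {E ι ι' : Type*} (k : E → E → ℝ) (a : ι → E) (b : ι' → E) : Matrix ι ι' ℝ :=
  Matrix.of fun i j => k (a i) (b j)

/-- The information gain `(1/2) log det (I + τ⁻¹ K)` of the points `a`. -/
def infoGain {E : Type*} (k : E → E → ℝ) (τ : ℝ) {T : ℕ} (a : Fin T → E) : ℝ :=
  (1 / 2) * Real.log (1 + τ⁻¹ • kernelMatrix k a a).det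

/-- The maximal information gain `γ_T`. -/
def maxInfoGain {E : Type*} (k : E → E → ℝ) (W : Set E) (τ : ℝ) (T : ℕ) : ℝ :=
  sSup {g | ∃ a : Fin T → E, (∀ i, a i ∈ W) ∧ g = infoGain k τ a}

/-- `K = ⌈T / γ_T⌉`; the approximating set has `T * K` points. -/
def oversampling {E : Type*} (k : E → E → ℝ) (W : Set E) (τ : ℝ) (T : ℕ) : ℕ :=
  ⌈(T : ℝ) / maxInfoGain k W τ T⌉₊

/-- The estimator `μ̄` computed from the data points `a`, the rewards `y` and the approximating
points `z`, with parameter `K`. -/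
def muBar {E ι ι' : Type*} [Fintype ι] [Fintype ι'] [DecidableEq ι'] (k : E → E → ℝ) (τ : ℝ)
    (K : ℕ) (a : ι → E) (y : ι → ℝ) (z : ι' → E) (w : E) : ℝ :=
  (1 / τ) * ((fun i => k (a i) w) ⬝ᵥ y -
    (fun i => k (z i) w) ⬝ᵥ
      ((kernelMatrix k z z + ((K : ℝ) * τ) • (1 : Matrix ι' ι' ℝ))⁻¹ *ᵥ
        (kernelMatrix k z a *ᵥ y)))

/-- The surrogate variance `σ̄²` computed from the approximating points `z`, with parameter `K`. -/
def varBar {E ι' : Type*} [Fintype ι'] [DecidableEq ι'] (k : E → E → ℝ) (τ : ℝ)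
    (K : ℕ) (z : ι' → E) (w : E) : ℝ :=
  (1 / τ) * (k w w -
    (fun i => k (z i) w) ⬝ᵥ
      ((kernelMatrix k z z + ((K : ℝ) * τ) • (1 : Matrix ι' ι' ℝ))⁻¹ *ᵥ
        (fun i => k (z i) w)))

/-- A database `(c_1, y_1), …, (c_T, y_T), c_{T+1}`. -/
structure Database (d' T : ℕ) where
  context : Fin T → EuclideanSpace ℝ (Fin d')
  reward : Fin T → ℝ
  evalContext : EuclideanSpace ℝ (Fin d')

/-- The contexts lie in `C` and the rewards are smaller than `B` in absolute value. -/
def Database.Admissible {d' T : ℕ} (S : Database d' T) (C : Set (EuclideanSpace ℝ (Fin d')))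
    (B : ℝ) : Prop :=
  (∀ i, S.context i ∈ C) ∧ (∀ i, |S.reward i| < B) ∧ S.evalContext ∈ C

/-- `S` and `S'` differ at most in the context and the reward at time `t`. -/
def Database.IsNeighbour {d' T : ℕ} (t : Fin T) (S S' : Database d' T) : Prop :=
  (∀ i, i ≠ t → S.context i = S'.context i ∧ S.reward i = S'.reward i) ∧
    S.evalContext = S'.evalContext

/-- All values `|μ̄_T(w) - μ̄'_T(w)|`, for `w ∈ X × C` and pairs of admissible `t`-neighbouring
databases. The query points `x` and the approximating points `z`, which do not depend on the
database, are the same for both databases. -/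
def sensitivityValues {d d' : ℕ} (k : Pt d d' → Pt d d' → ℝ)
    (X : Set (EuclideanSpace ℝ (Fin d))) (C : Set (EuclideanSpace ℝ (Fin d')))
    (τ B : ℝ) {T : ℕ} (t : Fin T) (x : Fin T → EuclideanSpace ℝ (Fin d))
    (K : ℕ) (z : Fin (T * K) → Pt d d') : Set ℝ :=
  {r | ∃ w ∈ X ×ˢ C, ∃ S S' : Database d' T, S.Admissible C B ∧ S'.Admissible C B ∧
    Database.IsNeighbour t S S' ∧
    r = |muBar k τ K (fun i => (x i, S.context i)) S.reward z w -
      muBar k τ K (fun i => (x i, S'.context i)) S'.reward z w|}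

/-- The constant `N̄₁(δ) = (log (1/δ) / (16 Cp F²)) ^ (2 βp / (βp - 1))`. -/
def Nbar₁ (Cp βp F δ : ℝ) : ℝ :=
  (Real.log (1 / δ) / (16 * Cp * F ^ 2)) ^ (2 * βp / (βp - 1))

end USCA

end

/-! Sensitivity. The estimator is a linear combination of the rewards: the coefficient of the reward
observed at `a i` is the posterior covariance `postCov` between `w` and `a i` (`muBar_eq_sum`).
Neighbouring databases therefore differ in one summand only. Positivity of the posterior covariance
bounds that covariance by the largest variance, and each of the two rewards costs a factor `B`.

Variance. Let dim be the effective dimension, the sum of `p j = T λ_j / (T λ_j + τ)`. By the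
variational form of ridge regression (`varBar_le`), a lower bound for the empirical second moment of
the features turns into an upper bound for the variance. Whitened so that the mean is the identity,
the second moment of one random point has quadratic form at most `F ^ 2 * dim + 1`, and polynomial
eigendecay makes this `O(T ^ a)` with `a < 1`. A one-sided matrix Chernoff bound then gives the
fraction 10/27 of the mean with high probability once `T` is large. It is proved through the random
product of the contractions `1 - θ X_i`: a dyadic Araki–Lieb–Thirring inequality makes the expected
trace of a power of the product decay exponentially, and a product of small norm forces the sum of
the `X_i` to be large. Only the first `T ^ m` Mercer features are used; the tail costs `O(T ^
(-2))`. The outcome is a variance of at most `(27/10 + 1/5) F² dim / T`.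

Information gain. It remains to show `19/40 dim ≤ γ_T`. A fixed finite design first makes the
variance at most 1/40 everywhere; the other points are then added one at a time, each at least as
good as a random point of law `ϱ` for a suitable potential (`exists_point_gainBound_le`). Since
`29/10 * 40/19 < 81/13`, the claimed constant follows. -/

noncomputable section

namespace USCA

/-! ### Trace inequalities and products of contractions. -/

section TraceInequalities

variable {n : Type*} [Fintype n]

theorem two_mul_trace_mul_le (A B : Matrix n n ℝ) :
    2 * trace (A * B) ≤ trace (A * Aᵀ) + trace (Bᵀ * B) := by
  have h1 : trace (A * B) = ∑ i, ∑ j, A i j * B j i := by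
    simp [trace, Matrix.mul_apply]
  have h2 : trace (A * Aᵀ) = ∑ i, ∑ j, A i j * A i j := by
    simp [trace, Matrix.mul_apply]
  have h3 : trace (Bᵀ * B) = ∑ i, ∑ j, B j i * B j i := by
    simp [trace, Matrix.mul_apply]
  rw [h1, h2, h3, Finset.mul_sum, ← Finset.sum_add_distrib]
  refine Finset.sum_le_sum fun i _ => ?_
  rw [Finset.mul_sum, ← Finset.sum_add_distrib]
  exact Finset.sum_le_sum fun j _ => by nlinarith [sq_nonneg (A i j - B j i)]

theorem dotProduct_sq_le (u v : n → ℝ) : (u ⬝ᵥ v) ^ 2 ≤ (u ⬝ᵥ u) * (v ⬝ᵥ v) := by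
  have := Finset.sum_mul_sq_le_sq_mul_sq Finset.univ u v
  simpa [dotProduct, sq] using this

theorem dotProduct_mulVec_self_nonneg {X : Matrix n n ℝ} (hX : X.PosSemidef) (v : n → ℝ) :
    0 ≤ v ⬝ᵥ (X *ᵥ v) := by
  simpa using hX.dotProduct_mulVec_nonneg v

theorem dotProduct_mulVec_comm {X : Matrix n n ℝ} (hX : X.PosSemidef) (u v : n → ℝ) :
    u ⬝ᵥ (X *ᵥ v) = v ⬝ᵥ (X *ᵥ u) := by
  have hsymm : Xᵀ = X := by simpa using hX.isHermitian.eq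
  rw [dotProduct_mulVec, ← mulVec_transpose, hsymm, dotProduct_comm]

theorem mulVec_dotProduct_mulVec_le {X : Matrix n n ℝ} (hX : X.PosSemidef) {R : ℝ}
    (hR0 : 0 ≤ R) (hR : ∀ v : n → ℝ, v ⬝ᵥ (X *ᵥ v) ≤ R * (v ⬝ᵥ v)) (v : n → ℝ) :
    (X *ᵥ v) ⬝ᵥ (X *ᵥ v) ≤ R * (v ⬝ᵥ (X *ᵥ v)) := by
  set y := X *ᵥ v with hy
  have hyy : 0 ≤ y ⬝ᵥ y := by simpa using dotProduct_star_self_nonneg y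
  have h1 := hR y
  have hvv := dotProduct_mulVec_self_nonneg hX v
  rcases hR0.eq_or_lt with rfl | hRpos
  -- For `R = 0` the test vector `R • v - y` carries no information. Both quadratic forms vanish
  -- here, so this combination leaves only the cross term, which forces `y ⬝ᵥ y = 0`.
  · have h2 := dotProduct_mulVec_self_nonneg hX ((y ⬝ᵥ (X *ᵥ y) + 1) • v - (y ⬝ᵥ y) • y)
    have h3 := dotProduct_mulVec_self_nonneg hX y
    have h5 : v ⬝ᵥ (X *ᵥ v) = 0 := le_antisymm (by simpa using hR v) hvv
    have h6 : y ⬝ᵥ (X *ᵥ y) = 0 := le_antisymm (by simpa using hR y) h3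
    simp only [mulVec_sub, mulVec_smul, sub_dotProduct, dotProduct_sub, smul_dotProduct,
      dotProduct_smul, smul_eq_mul, dotProduct_mulVec_comm hX v y, h5, h6] at h2
    rw [← hy] at h2
    nlinarith
  · have h2 := dotProduct_mulVec_self_nonneg hX (R • v - y)
    simp only [mulVec_sub, mulVec_smul, sub_dotProduct, dotProduct_sub, smul_dotProduct,
      dotProduct_smul, smul_eq_mul, dotProduct_mulVec_comm hX v y] at h2
    rw [← hy] at h2
    nlinarith

variable [DecidableEq n]

theorem trace_mul_pow_comm (A B : Matrix n n ℝ) (m : ℕ) :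
    trace ((A * B) ^ m) = trace ((B * A) ^ m) := by
  cases m with
  | zero => simp
  | succ m =>
    rw [pow_succ, ← mul_assoc, mul_pow_mul, trace_mul_comm, ← mul_assoc, ← pow_succ']

/-- The two claims feed each other. The first for `M` follows from both at the previous level,
applied to `M ^ 2` and to the pair `M Mᵀ`, `Mᵀ M`, whose powers have equal traces. The second
follows from the first applied to `A * B`, because cyclicity turns `A B B A` into `A² B²`. -/
theorem trace_pow_two_pow_le (k : ℕ) :
    (∀ M : Matrix n n ℝ, trace (M ^ 2 ^ (k + 1)) ≤ trace ((M * Mᵀ) ^ 2 ^ k)) ∧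
    (∀ A B : Matrix n n ℝ, Aᵀ = A → Bᵀ = B →
      trace ((A * B) ^ 2 ^ k) ≤ trace (A ^ 2 ^ k * B ^ 2 ^ k)) := by
  induction k with
  | zero =>
    refine ⟨fun M => ?_, fun A B _ _ => by simp⟩
    have h := two_mul_trace_mul_le M M
    rw [trace_mul_comm Mᵀ M] at h
    simp only [zero_add, pow_one, pow_zero, sq]
    linarith
  | succ k ih =>
    obtain ⟨ih1, ih2⟩ := ih
    refine ⟨fun M => ?_, fun A B hA hB => ?_⟩
    · have hP : (M * Mᵀ)ᵀ = M * Mᵀ := by simp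
      have hQ : (Mᵀ * M)ᵀ = Mᵀ * M := by simp
      have e1 : trace ((M ^ 2 * (M ^ 2)ᵀ) ^ 2 ^ k) = trace (((M * Mᵀ) * (Mᵀ * M)) ^ 2 ^ k) := by
        have : M ^ 2 * (M ^ 2)ᵀ = M * (M * Mᵀ * Mᵀ) := by
          simp [sq, mul_assoc]
        rw [this, trace_mul_pow_comm]
        simp [mul_assoc]
      have h1 := ih1 (M ^ 2)
      rw [← pow_mul, ← pow_succ', e1] at h1
      have h2 := ih2 _ _ hP hQ
      have h3 := two_mul_trace_mul_le ((M * Mᵀ) ^ 2 ^ k) ((Mᵀ * M) ^ 2 ^ k)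
      rw [transpose_pow, transpose_pow, hP, hQ, ← pow_add, ← pow_add, ← two_mul, ← pow_succ',
        trace_mul_pow_comm Mᵀ M] at h3
      linarith
    · have h1 := ih1 (A * B)
      have e1 : A * B * (A * B)ᵀ = A * (B * B * A) := by
        simp [hA, hB, mul_assoc]
      have e2 : B * B * A * A = (B * B) * (A * A) := by simp [mul_assoc]
      rw [e1, trace_mul_pow_comm A (B * B * A), e2, trace_mul_pow_comm (B * B)] at h1
      have h2 := ih2 (A * A) (B * B) (by simp [hA]) (by simp [hB])
      rw [← sq, ← sq, ← pow_mul, ← pow_mul, ← pow_succ'] at h2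
      rw [← sq, ← sq] at h1
      linarith

/-- The Araki–Lieb–Thirring trace inequality for dyadic exponents. -/
theorem trace_mul_pow_two_pow_le {A B : Matrix n n ℝ} (hA : Aᵀ = A) (hB : Bᵀ = B) (k : ℕ) :
    trace ((A * B) ^ 2 ^ k) ≤ trace (A ^ 2 ^ k * B ^ 2 ^ k) :=
  (trace_pow_two_pow_le k).2 A B hA hB

theorem dotProduct_mulVec_le_trace {G : Matrix n n ℝ} (hG : G.PosSemidef) (v : n → ℝ) :
    v ⬝ᵥ (G *ᵥ v) ≤ trace G * (v ⬝ᵥ v) := by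
  obtain ⟨B, rfl⟩ := (by
    open scoped MatrixOrder in exact CStarAlgebra.nonneg_iff_eq_star_mul_self.mp hG.nonneg)
  have h1 : v ⬝ᵥ ((star B * B) *ᵥ v) = ∑ i, (B i ⬝ᵥ v) ^ 2 := by
    rw [← mulVec_mulVec, dotProduct_mulVec, star_eq_conjTranspose,
      conjTranspose_eq_transpose_of_trivial, vecMul_transpose]
    simp [dotProduct, mulVec, sq]
  have h2 : trace (star B * B) = ∑ i, B i ⬝ᵥ B i := by
    rw [trace_mul_comm, star_eq_conjTranspose, conjTranspose_eq_transpose_of_trivial]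
    simp [trace, Matrix.mul_apply, dotProduct]
  rw [h1, h2, Finset.sum_mul]
  exact Finset.sum_le_sum fun i _ => dotProduct_sq_le _ _

/-- The largest eigenvalue of a positive semidefinite matrix is at most its trace. Cauchy–Schwarz,
`(v·Gv)² ≤ |v|² |Gv|²`, passes from `G ^ 2` back to `G`, so squaring repeatedly reaches every dyadic
power. -/
theorem dotProduct_mulVec_le_of_trace_pow_le (k : ℕ) {G : Matrix n n ℝ} (hG : G.PosSemidef)
    {g : ℝ} (hg : 0 ≤ g) (h : trace (G ^ 2 ^ k) ≤ g ^ 2 ^ k) (v : n → ℝ) :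
    v ⬝ᵥ (G *ᵥ v) ≤ g * (v ⬝ᵥ v) := by
  have hvv : 0 ≤ v ⬝ᵥ v := by simpa using dotProduct_star_self_nonneg v
  induction k generalizing G g with
  | zero =>
    simp only [pow_zero, pow_one] at h
    exact (dotProduct_mulVec_le_trace hG v).trans (mul_le_mul_of_nonneg_right h hvv)
  | succ k ih =>
    have hsymm : Gᵀ = G := by simpa using hG.isHermitian.eq
    have h2 := ih (hG.pow 2) (sq_nonneg g) (by rwa [← pow_mul, ← pow_mul, ← pow_succ'])
    have e : v ⬝ᵥ ((G ^ 2) *ᵥ v) = (G *ᵥ v) ⬝ᵥ (G *ᵥ v) := by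
      rw [sq, ← mulVec_mulVec, dotProduct_mulVec, ← mulVec_transpose, hsymm]
    rw [e] at h2
    refine le_of_sq_le_sq ?_ (by positivity)
    calc (v ⬝ᵥ (G *ᵥ v)) ^ 2 ≤ (v ⬝ᵥ v) * ((G *ᵥ v) ⬝ᵥ (G *ᵥ v)) := dotProduct_sq_le _ _
      _ ≤ (v ⬝ᵥ v) * (g ^ 2 * (v ⬝ᵥ v)) := mul_le_mul_of_nonneg_left h2 hvv
      _ = (g * (v ⬝ᵥ v)) ^ 2 := by ring

/-- A polynomial that is nonnegative on the spectrum gives a positive semidefinite matrix, and the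
trace of a product of two such matrices is nonnegative. This lifts scalar inequalities to traces. -/
theorem trace_mul_aeval_nonneg {A X : Matrix n n ℝ} (hA : A.PosSemidef) (hX : X.IsHermitian)
    (q : Polynomial ℝ) (hq : ∀ i, 0 ≤ q.eval (hX.eigenvalues i)) :
    0 ≤ trace (A * Polynomial.aeval X q) := by
  classical
  let e := Unitary.conjStarAlgAut ℝ (Matrix n n ℝ) hX.eigenvectorUnitary
  have hX' : X = e (diagonalAlgHom ℝ hX.eigenvalues) := hX.spectral_theorem
  have h1 : Polynomial.aeval X q = e (diagonal fun i => q.eval (hX.eigenvalues i)) := by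
    conv_lhs => rw [hX']
    have h2 := Polynomial.aeval_algHom_apply
      ((e.toAlgEquiv : Matrix n n ℝ →ₐ[ℝ] Matrix n n ℝ).comp (diagonalAlgHom ℝ)) hX.eigenvalues q
    refine h2.trans ?_
    have h3 : Polynomial.aeval hX.eigenvalues q = fun i => q.eval (hX.eigenvalues i) := by
      funext i
      simp [Polynomial.aeval_def]
    rw [h3]
    rfl
  have h4 : (e (diagonal fun i => q.eval (hX.eigenvalues i))).PosSemidef := by
    have : e (diagonal fun i => q.eval (hX.eigenvalues i)) =
        (hX.eigenvectorUnitary : Matrix n n ℝ) * (diagonal fun i => q.eval (hX.eigenvalues i)) *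
          (hX.eigenvectorUnitary : Matrix n n ℝ)ᴴ := by
      simp [e, Unitary.conjStarAlgAut_apply, star_eq_conjTranspose]
    rw [this]
    exact (PosSemidef.diagonal hq).mul_mul_conjTranspose_same _
  rw [h1]
  obtain ⟨B, hB⟩ := (by
    open scoped MatrixOrder in exact CStarAlgebra.nonneg_iff_eq_star_mul_self.mp hA.nonneg)
  rw [hB, mul_assoc, trace_mul_comm, star_eq_conjTranspose]
  exact (h4.mul_mul_conjTranspose_same B).trace_nonneg

theorem one_sub_pow_le {y : ℝ} (hy0 : 0 ≤ y) (hy1 : y ≤ 1) (m : ℕ) :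
    (1 - y) ^ m ≤ 1 - m * y + (m * y) ^ 2 / 2 := by
  have h1 : (1 - y) ^ m ≤ Real.exp (-(m * y)) := by
    rw [show -(m * y) = (m : ℝ) * (-y) by ring, Real.exp_nat_mul]
    refine pow_le_pow_left₀ (by linarith) ?_ m
    linarith [Real.add_one_le_exp (-y)]
  refine h1.trans ?_
  have hx : 0 ≤ (m : ℝ) * y := by positivity
  generalize (m : ℝ) * y = x at hx
  have h2 := Real.quadratic_le_exp_of_nonneg hx
  have h3 : 0 < 1 + x + x ^ 2 / 2 := by positivity
  rw [Real.exp_neg]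
  refine (inv_anti₀ h3 h2).trans ?_
  rw [inv_le_iff_one_le_mul₀ h3]
  -- `(1 + x + x²/2)(1 - x + x²/2) = 1 + x⁴/4`.
  nlinarith [sq_nonneg (x ^ 2)]

/-- One factor of the random product contracts the trace of a power. -/
theorem trace_mul_one_sub_smul_pow_le {A X : Matrix n n ℝ} (hA : A.PosSemidef)
    (hX : X.PosSemidef) {R θ : ℝ} (hR : ∀ v : n → ℝ, v ⬝ᵥ (X *ᵥ v) ≤ R * (v ⬝ᵥ v))
    (hθ : 0 ≤ θ) (hθR : θ * R ≤ 1) (p : ℕ) :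
    trace (A * (1 - θ • X) ^ (2 * p)) ≤
      trace A - 2 * p * θ * (1 - p * θ * R) * trace (A * X) := by
  have hH := hX.isHermitian
  let κ := 2 * p * θ * (1 - p * θ * R)
  -- The difference of the two sides at an eigenvalue `μ`. It is nonnegative on `[0, R]` because `(1
  -- - θμ)^(2p) ≤ 1 - 2pθμ + 2p²θ²μ²` and `μ² ≤ R μ`.
  let q : Polynomial ℝ := 1 - Polynomial.C κ * Polynomial.X -
    (1 - Polynomial.C θ * Polynomial.X) ^ (2 * p)
  have hq : ∀ i, 0 ≤ q.eval (hH.eigenvalues i) := by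
    intro i
    have h0 := hX.eigenvalues_nonneg i
    have h1 : hH.eigenvalues i ≤ R := by
      have e1 := hH.eigenvalues_eq i
      have e2 := hR ⇑(hH.eigenvectorBasis i)
      have e3 : (⇑(hH.eigenvectorBasis i) : n → ℝ) ⬝ᵥ ⇑(hH.eigenvectorBasis i) = 1 := by
        have := hH.eigenvectorBasis.orthonormal.1 i
        have h4 := EuclideanSpace.real_norm_sq_eq (hH.eigenvectorBasis i)
        rw [this] at h4
        simpa [dotProduct, sq] using h4.symm
      rw [e3] at e2
      simp only [star_trivial, RCLike.re_to_real] at e1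
      linarith
    generalize hH.eigenvalues i = μ at h0 h1
    have h2 : θ * μ ≤ θ * R := mul_le_mul_of_nonneg_left h1 hθ
    have h3 := one_sub_pow_le (y := θ * μ) (by positivity) (by linarith) (2 * p)
    have h4 : (p : ℝ) ^ 2 * θ * μ * (θ * μ) ≤ (p : ℝ) ^ 2 * θ * μ * (θ * R) :=
      mul_le_mul_of_nonneg_left h2 (by positivity)
    simp only [q, κ, Polynomial.eval_sub, Polynomial.eval_pow, Polynomial.eval_mul,
      Polynomial.eval_one, Polynomial.eval_C, Polynomial.eval_X]
    push_cast at h3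
    nlinarith
  have h := trace_mul_aeval_nonneg hA hH q hq
  have e : Polynomial.aeval X q = 1 - κ • X - (1 - θ • X) ^ (2 * p) := by
    simp [q, Algebra.smul_def]
  rw [e, mul_sub, mul_sub, mul_one, Matrix.mul_smul, trace_sub, trace_sub, trace_smul, smul_eq_mul] at h
  linarith

/-- The ordered product of the factors `1 - θ • X i`. -/
def contractionProduct (θ : ℝ) {N : ℕ} (X : Fin N → Matrix n n ℝ) : Matrix n n ℝ :=
  (List.ofFn fun i => 1 - θ • X i).prod

theorem contractionProduct_succ (θ : ℝ) {N : ℕ} (X : Fin (N + 1) → Matrix n n ℝ) :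
    contractionProduct θ X = (1 - θ • X 0) * contractionProduct θ (fun i => X i.succ) := by
  simp [contractionProduct, List.ofFn_succ]

/-- The factors act on `v` as successive gradient steps. By `X² ≤ R X` and `θ R ≤ 1`, one step
changes the squared distance to `u` by at most `-θ v·Xv + 2θ u·Xv`, which is at most `θ u·Xu` by
positivity of `X` at `v - u`. The transpose makes the first factor act first. -/
theorem contractionProduct_energy {θ R : ℝ} (hθ : 0 ≤ θ) (hR0 : 0 ≤ R) (hθR : θ * R ≤ 1) {N : ℕ}
    (X : Fin N → Matrix n n ℝ) (hX : ∀ i, (X i).PosSemidef)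
    (hR : ∀ i, ∀ v : n → ℝ, v ⬝ᵥ (X i *ᵥ v) ≤ R * (v ⬝ᵥ v)) (v u : n → ℝ) :
    ((contractionProduct θ X)ᵀ *ᵥ v - u) ⬝ᵥ ((contractionProduct θ X)ᵀ *ᵥ v - u) ≤
      (v - u) ⬝ᵥ (v - u) + θ * ∑ i, u ⬝ᵥ (X i *ᵥ u) := by
  induction N generalizing v with
  | zero => simp [contractionProduct]
  | succ N ih =>
    have hs : (X 0)ᵀ = X 0 := by simpa using (hX 0).isHermitian.eq
    have h1 := ih (fun i => X i.succ) (fun i => hX _) (fun i => hR _) (v - θ • (X 0 *ᵥ v))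
    have e : (contractionProduct θ X)ᵀ *ᵥ v =
        (contractionProduct θ (fun i => X i.succ))ᵀ *ᵥ (v - θ • (X 0 *ᵥ v)) := by
      rw [contractionProduct_succ, transpose_mul, ← mulVec_mulVec]
      simp [hs, sub_mulVec, smul_mulVec]
    rw [e, Fin.sum_univ_succ]
    refine h1.trans ?_
    have h2 := mulVec_dotProduct_mulVec_le (hX 0) hR0 (hR 0) v
    have h3 := dotProduct_mulVec_self_nonneg (hX 0) (v - u)
    have h4 := dotProduct_mulVec_self_nonneg (hX 0) v
    have h5 : θ ^ 2 * ((X 0 *ᵥ v) ⬝ᵥ (X 0 *ᵥ v)) ≤ θ * (v ⬝ᵥ (X 0 *ᵥ v)) := by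
      calc θ ^ 2 * ((X 0 *ᵥ v) ⬝ᵥ (X 0 *ᵥ v)) ≤ θ ^ 2 * (R * (v ⬝ᵥ (X 0 *ᵥ v))) :=
            mul_le_mul_of_nonneg_left h2 (sq_nonneg _)
        _ = (θ * R) * (θ * (v ⬝ᵥ (X 0 *ᵥ v))) := by ring
        _ ≤ 1 * (θ * (v ⬝ᵥ (X 0 *ᵥ v))) := mul_le_mul_of_nonneg_right hθR (by positivity)
        _ = _ := one_mul _
    have h6 := mul_nonneg hθ h3
    have e1 : (X 0 *ᵥ v) ⬝ᵥ v = v ⬝ᵥ (X 0 *ᵥ v) := dotProduct_comm _ _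
    have e2 : (X 0 *ᵥ v) ⬝ᵥ u = v ⬝ᵥ (X 0 *ᵥ u) := by
      rw [dotProduct_comm, dotProduct_mulVec_comm (hX 0)]
    simp only [mulVec_sub, sub_dotProduct, dotProduct_sub, smul_dotProduct,
      dotProduct_smul, smul_eq_mul, e1, e2, dotProduct_mulVec_comm (hX 0) u v] at h6 ⊢
    linarith

/-- If the product of the contractions has operator norm at most `g`, certified by the trace of a
power, then the sum of the `X i` is bounded below. -/
theorem le_sum_dotProduct_mulVec_of_trace_pow_le {θ R g : ℝ} (hθ : 0 ≤ θ) (hR0 : 0 ≤ R)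
    (hθR : θ * R ≤ 1) (hg0 : 0 < g) (hg1 : g ≤ 1) {N : ℕ}
    (X : Fin N → Matrix n n ℝ) (hX : ∀ i, (X i).PosSemidef)
    (hR : ∀ i, ∀ v : n → ℝ, v ⬝ᵥ (X i *ᵥ v) ≤ R * (v ⬝ᵥ v)) (k : ℕ)
    (h : trace ((contractionProduct θ X * (contractionProduct θ X)ᵀ) ^ 2 ^ k) ≤ (g ^ 2) ^ 2 ^ k)
    (v : n → ℝ) :
    (1 - g) ^ 2 * (v ⬝ᵥ v) ≤ θ * ∑ i, v ⬝ᵥ (X i *ᵥ v) := by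
  set P := contractionProduct θ X
  have hG : (P * Pᵀ).PosSemidef := by simpa using posSemidef_self_mul_conjTranspose P
  have h1 := dotProduct_mulVec_le_of_trace_pow_le k hG (sq_nonneg g) h v
  rw [← mulVec_mulVec, dotProduct_mulVec, ← mulVec_transpose] at h1
  have h2 := contractionProduct_energy hθ hR0 hθR X hX hR v v
  set y := Pᵀ *ᵥ v
  -- Together with `|y| ≤ g |v|` this replaces the triangle inequality `|y - v| ≥ (1 - g) |v|`
  -- without square roots; the result appears multiplied by `g`.
  have h3 : 0 ≤ (y - g • v) ⬝ᵥ (y - g • v) := by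
    simpa using dotProduct_star_self_nonneg (y - g • v)
  simp only [sub_self, sub_dotProduct, dotProduct_sub, smul_dotProduct,
      dotProduct_smul, smul_eq_mul, dotProduct_comm v y, zero_dotProduct] at h2 h3
  have h5 := mul_le_mul_of_nonneg_left h2 hg0.le
  have h6 := mul_le_mul_of_nonneg_left h1 (sub_nonneg.2 hg1)
  have h4 : g * ((1 - g) ^ 2 * (v ⬝ᵥ v)) ≤ g * (θ * ∑ i, v ⬝ᵥ (X i *ᵥ v)) := by
    nlinarith
  exact le_of_mul_le_mul_left h4 hg0

end TraceInequalities

/-! ### Random products and a matrix Chernoff bound. -/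

section RandomProducts

variable {n Ω : Type*} [Fintype n] [MeasurableSpace Ω]

theorem measurable_mul_entry {Ω' : Type*} [MeasurableSpace Ω'] {A B : Ω' → Matrix n n ℝ}
    (hA : ∀ i j, Measurable fun ω => A ω i j) (hB : ∀ i j, Measurable fun ω => B ω i j) (i j : n) :
    Measurable fun ω => (A ω * B ω) i j := by
  simp only [Matrix.mul_apply]
  exact Finset.measurable_sum _ fun l _ => (hA i l).mul (hB l j)

variable [DecidableEq n]

theorem measurable_pow_entry {Ω' : Type*} [MeasurableSpace Ω'] {A : Ω' → Matrix n n ℝ}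
    (hA : ∀ i j, Measurable fun ω => A ω i j) (m : ℕ) (i j : n) :
    Measurable fun ω => (A ω ^ m) i j := by
  induction m generalizing i j with
  | zero => simp only [pow_zero]; exact measurable_const
  | succ m ih => simp only [pow_succ]; exact measurable_mul_entry ih hA i j

theorem measurable_contractionProduct_entry {X : Ω → Matrix n n ℝ}
    (hX : ∀ i j, Measurable fun ω => X ω i j) (θ : ℝ) (N : ℕ) (i j : n) :
    Measurable fun z : Fin N → Ω => contractionProduct θ (fun l => X (z l)) i j := by
  induction N generalizing i j with
  | zero => simp only [contractionProduct, List.ofFn_zero]; exact measurable_const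
  | succ N ih =>
    simp only [contractionProduct_succ]
    refine measurable_mul_entry (A := fun z : Fin (N + 1) → Ω => 1 - θ • X (z 0))
      (fun i j => ?_) (fun i j => ?_) i j
    · simp only [Matrix.sub_apply, Matrix.smul_apply]
      exact measurable_const.sub (((hX i j).comp (measurable_pi_apply 0)).const_smul θ)
    · exact (ih i j).comp (measurable_pi_lambda _ fun l => measurable_pi_apply _)

theorem measurable_trace_contractionProduct {X : Ω → Matrix n n ℝ}
    (hX : ∀ i j, Measurable fun ω => X ω i j) (θ : ℝ) (N m : ℕ) :
    Measurable fun z : Fin N → Ω =>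
      trace ((contractionProduct θ (fun l => X (z l)) *
        (contractionProduct θ (fun l => X (z l)))ᵀ) ^ m) := by
  simp only [trace, diag_apply]
  exact Finset.measurable_sum _ fun i _ => measurable_pow_entry
    (measurable_mul_entry (measurable_contractionProduct_entry hX θ N)
      (fun i j => measurable_contractionProduct_entry hX θ N j i)) m i i

theorem integral_trace_mul {μ : Measure Ω} {X : Ω → Matrix n n ℝ}
    (hint : ∀ i j, Integrable (fun ω => X ω i j) μ)
    (hmean : ∀ i j, ∫ ω, X ω i j ∂μ = (1 : Matrix n n ℝ) i j) (A : Matrix n n ℝ) :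
    Integrable (fun ω => trace (A * X ω)) μ ∧ ∫ ω, trace (A * X ω) ∂μ = trace A := by
  have e : (fun ω => trace (A * X ω)) = fun ω => ∑ i, ∑ j, A i j * X ω j i := by
    funext ω; simp [trace, Matrix.mul_apply]
  rw [e]
  refine ⟨integrable_finsetSum _ fun i _ => integrable_finsetSum _ fun j _ =>
    (hint j i).const_mul _, ?_⟩
  have e1 : ∫ ω, ∑ i, ∑ j, A i j * X ω j i ∂μ = ∑ i, ∑ j, A i j * (1 : Matrix n n ℝ) j i := by
    refine (integral_finsetSum _ fun i _ => integrable_finsetSum _ fun j _ =>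
      (hint j i).const_mul (A i j)).trans (Finset.sum_congr rfl fun i _ => ?_)
    refine (integral_finsetSum _ fun j _ => (hint j i).const_mul (A i j)).trans
      (Finset.sum_congr rfl fun j _ => ?_)
    rw [integral_const_mul, hmean]
  rw [e1]
  simp [trace, Matrix.one_apply]

/-- Up to cyclic order the new Gram matrix is `P Pᵀ (1 - θ X)²`. The dyadic trace inequality
separates the powers of the two factors, leaving an expression linear in `X` that can be averaged.
-/
theorem trace_mul_mul_transpose_pow_le {X : Matrix n n ℝ} (P : Matrix n n ℝ) (hX : X.PosSemidef)
    {R θ : ℝ} (hR : ∀ v : n → ℝ, v ⬝ᵥ (X *ᵥ v) ≤ R * (v ⬝ᵥ v)) (hθ : 0 ≤ θ) (hθR : θ * R ≤ 1)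
    (k : ℕ) :
    trace (((1 - θ • X) * P * ((1 - θ • X) * P)ᵀ) ^ 2 ^ k) ≤ trace ((P * Pᵀ) ^ 2 ^ k) -
      2 * 2 ^ k * θ * (1 - 2 ^ k * θ * R) * trace ((P * Pᵀ) ^ 2 ^ k * X) := by
  have hG : (P * Pᵀ).PosSemidef := by simpa using posSemidef_self_mul_conjTranspose P
  have hZ : (1 - θ • X)ᵀ = 1 - θ • X := by
    have : Xᵀ = X := by simpa using hX.isHermitian.eq
    simp [this]
  have e2 : (1 - θ • X) * P * ((1 - θ • X) * P)ᵀ = ((1 - θ • X) * (P * Pᵀ)) * (1 - θ • X) := by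
    rw [transpose_mul, hZ]; simp only [mul_assoc]
  rw [e2, trace_mul_pow_comm, ← mul_assoc, trace_mul_pow_comm]
  refine (trace_mul_pow_two_pow_le (by simp) (by simp only [transpose_mul, hZ]) k).trans ?_
  rw [← sq, ← pow_mul]
  have := trace_mul_one_sub_smul_pow_le (hG.pow (2 ^ k)) hX hR hθ hθR (2 ^ k)
  push_cast at this
  exact this

/-- With the later factors fixed, averaging over the first one replaces `X` by its mean, the
identity. Each factor thus contributes `1 - κ ≤ exp (-κ)`, and the empty product has trace `card n`.
-/
theorem lintegral_trace_contractionProduct_le {μ : Measure Ω} [IsProbabilityMeasure μ]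
    {X : Ω → Matrix n n ℝ} (hmeas : ∀ i j, Measurable fun ω => X ω i j)
    (hint : ∀ i j, Integrable (fun ω => X ω i j) μ)
    (hmean : ∀ i j, ∫ ω, X ω i j ∂μ = (1 : Matrix n n ℝ) i j)
    (hX : ∀ ω, (X ω).PosSemidef) {R θ : ℝ}
    (hR : ∀ ω, ∀ v : n → ℝ, v ⬝ᵥ (X ω *ᵥ v) ≤ R * (v ⬝ᵥ v))
    (hθ : 0 ≤ θ) (hθR : θ * R ≤ 1) (k N : ℕ) :
    ∫⁻ z : Fin N → Ω, ENNReal.ofReal (trace ((contractionProduct θ (fun l => X (z l)) *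
        (contractionProduct θ (fun l => X (z l)))ᵀ) ^ 2 ^ k)) ∂Measure.pi (fun _ => μ) ≤
      ENNReal.ofReal (Fintype.card n *
        Real.exp (-(2 * 2 ^ k * θ * (1 - 2 ^ k * θ * R) * N))) := by
  set κ : ℝ := 2 * 2 ^ k * θ * (1 - 2 ^ k * θ * R) with hκ
  induction N with
  | zero => simp [contractionProduct]
  | succ N ih =>
    let e := MeasurableEquiv.piFinSuccAbove (fun _ : Fin (N + 1) => Ω) 0
    have he : MeasurePreserving e (Measure.pi fun _ => μ) (μ.prod (Measure.pi fun _ => μ)) :=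
      measurePreserving_piFinSuccAbove (fun _ : Fin (N + 1) => μ) 0
    let f : (Fin (N + 1) → Ω) → ENNReal := fun z =>
      ENNReal.ofReal (trace ((contractionProduct θ (fun l => X (z l)) *
        (contractionProduct θ (fun l => X (z l)))ᵀ) ^ 2 ^ k))
    have hf : Measurable f := (measurable_trace_contractionProduct hmeas θ (N + 1) _).ennreal_ofReal
    have h1 : ∫⁻ z, f z ∂Measure.pi (fun _ => μ) =
        ∫⁻ y, f (e.symm y) ∂μ.prod (Measure.pi fun _ => μ) := by
      refine Eq.trans ?_ (he.lintegral_comp (hf.comp e.symm.measurable))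
      simp
    rw [show (∫⁻ z : Fin (N + 1) → Ω, ENNReal.ofReal (trace ((contractionProduct θ
        (fun l => X (z l)) * (contractionProduct θ (fun l => X (z l)))ᵀ) ^ 2 ^ k))
        ∂Measure.pi (fun _ => μ)) = ∫⁻ z, f z ∂Measure.pi (fun _ => μ) from rfl, h1]
    refine (lintegral_prod_symm _ (hf.comp e.symm.measurable).aemeasurable).trans_le ?_
    have hstep : ∀ z : Fin N → Ω, ∫⁻ ω, f (e.symm (ω, z)) ∂μ ≤
        ENNReal.ofReal (Real.exp (-κ)) * ENNReal.ofReal (trace ((contractionProduct θ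
          (fun l => X (z l)) * (contractionProduct θ (fun l => X (z l)))ᵀ) ^ 2 ^ k)) := by
      intro z
      set P := contractionProduct θ (fun l => X (z l))
      set A := (P * Pᵀ) ^ 2 ^ k with hA
      have hG : (P * Pᵀ).PosSemidef := by simpa using posSemidef_self_mul_conjTranspose P
      have hApsd : A.PosSemidef := hG.pow _
      have hle : ∀ ω, f (e.symm (ω, z)) ≤ ENNReal.ofReal (trace A - κ * trace (A * X ω)) ∧
          0 ≤ trace A - κ * trace (A * X ω) := by
        intro ω
        have e1 : f (e.symm (ω, z)) = ENNReal.ofReal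
            (trace (((1 - θ • X ω) * P * ((1 - θ • X ω) * P)ᵀ) ^ 2 ^ k)) := by
          simp only [f, contractionProduct_succ]
          rfl
        have h2 := trace_mul_mul_transpose_pow_le P (hX ω) (hR ω) hθ hθR k
        refine ⟨?_, le_trans ?_ h2⟩
        · rw [e1]
          exact ENNReal.ofReal_le_ofReal h2
        · have := posSemidef_self_mul_conjTranspose ((1 - θ • X ω) * P)
          exact (this.pow _).trace_nonneg
      obtain ⟨hi, hm⟩ := integral_trace_mul hint hmean A
      calc ∫⁻ ω, f (e.symm (ω, z)) ∂μ
          ≤ ∫⁻ ω, ENNReal.ofReal (trace A - κ * trace (A * X ω)) ∂μ :=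
            lintegral_mono fun ω => (hle ω).1
        _ = ENNReal.ofReal (∫ ω, (trace A - κ * trace (A * X ω)) ∂μ) :=
            (ofReal_integral_eq_lintegral_ofReal ((integrable_const _).sub (hi.const_mul _))
              (ae_of_all _ fun ω => (hle ω).2)).symm
        _ = ENNReal.ofReal ((1 - κ) * trace A) := by
            rw [integral_sub (integrable_const _) (hi.const_mul _), integral_const_mul, hm]
            simp only [integral_const, probReal_univ, one_smul]
            ring_nf
        _ ≤ ENNReal.ofReal (Real.exp (-κ) * trace A) := by
            refine ENNReal.ofReal_le_ofReal (mul_le_mul_of_nonneg_right ?_ hApsd.trace_nonneg)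
            linarith [Real.add_one_le_exp (-κ)]
        _ = _ := ENNReal.ofReal_mul (Real.exp_pos _).le
    refine (lintegral_mono hstep).trans ?_
    rw [lintegral_const_mul' _ _ ENNReal.ofReal_ne_top]
    refine (mul_le_mul_right ih _).trans ?_
    rw [← ENNReal.ofReal_mul (Real.exp_pos _).le]
    refine ENNReal.ofReal_le_ofReal (le_of_eq ?_)
    rw [mul_left_comm, ← Real.exp_add]
    congr 2
    push_cast
    ring

/-- A one-sided matrix Chernoff bound, with the constant obtained from a step size `6 / (5 N)` and
a contraction to `1 / 3`. -/
theorem measure_exists_sum_lt_le {μ : Measure Ω} [IsProbabilityMeasure μ]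
    {X : Ω → Matrix n n ℝ} (hmeas : ∀ i j, Measurable fun ω => X ω i j)
    (hint : ∀ i j, Integrable (fun ω => X ω i j) μ)
    (hmean : ∀ i j, ∫ ω, X ω i j ∂μ = (1 : Matrix n n ℝ) i j)
    (hX : ∀ ω, (X ω).PosSemidef) {R : ℝ} (hR0 : 0 ≤ R)
    (hR : ∀ ω, ∀ v : n → ℝ, v ⬝ᵥ (X ω *ᵥ v) ≤ R * (v ⬝ᵥ v))
    (k N : ℕ) (hN : 0 < N) (hk : 2 ^ k * R * 36 ≤ N) :
    Measure.pi (fun _ : Fin N => μ) {z | ¬ ∀ v : n → ℝ,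
        10 / 27 * N * (v ⬝ᵥ v) ≤ ∑ i, v ⬝ᵥ (X (z i) *ᵥ v)} ≤
      ENNReal.ofReal (Fintype.card n * Real.exp (-(2 ^ k / 10))) := by
  have hN' : (0 : ℝ) < N := by exact_mod_cast hN
  set θ : ℝ := 6 / (5 * N) with hθdef
  have hθ : 0 ≤ θ := by positivity
  have hpθR : 2 ^ k * θ * R ≤ 1 / 30 := by
    have : 2 ^ k * θ * R = 2 ^ k * R * 36 / N * (1 / 30) := by rw [hθdef]; field_simp; ring
    rw [this]
    have : 2 ^ k * R * 36 / N ≤ 1 := (div_le_one hN').2 hk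
    linarith
  have hθR : θ * R ≤ 1 := by
    have h1 : (1 : ℝ) ≤ 2 ^ k := one_le_pow₀ (by norm_num)
    have : θ * R ≤ 2 ^ k * (θ * R) := le_mul_of_one_le_left (by positivity) h1
    linarith
  have hsub : {z : Fin N → Ω | ¬ ∀ v : n → ℝ,
        10 / 27 * N * (v ⬝ᵥ v) ≤ ∑ i, v ⬝ᵥ (X (z i) *ᵥ v)} ⊆
      {z | ENNReal.ofReal (((1 / 3 : ℝ) ^ 2) ^ 2 ^ k) ≤
        ENNReal.ofReal (trace ((contractionProduct θ (fun l => X (z l)) *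
        (contractionProduct θ (fun l => X (z l)))ᵀ) ^ 2 ^ k))} := by
    intro z hz
    by_contra hcon
    refine hz fun v => ?_
    simp only [Set.mem_ofPred_eq, not_le] at hcon
    have h1 := ENNReal.lt_ofReal_iff_toReal_lt ENNReal.ofReal_ne_top |>.1 hcon
    have h2 : trace ((contractionProduct θ (fun l => X (z l)) *
        (contractionProduct θ (fun l => X (z l)))ᵀ) ^ 2 ^ k) ≤ ((1 / 3 : ℝ) ^ 2) ^ 2 ^ k := by
      refine le_of_lt (lt_of_le_of_lt ?_ h1)
      rw [ENNReal.toReal_ofReal_eq_iff.2]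
      have hG := posSemidef_self_mul_conjTranspose (contractionProduct θ (fun l => X (z l)))
      simpa using (hG.pow (2 ^ k)).trace_nonneg
    have h3 := le_sum_dotProduct_mulVec_of_trace_pow_le hθ hR0 hθR (by norm_num) (by norm_num)
      (fun i => X (z i)) (fun i => hX _) (fun i => hR _) k h2 v
    rw [hθdef, div_mul_eq_mul_div, le_div_iff₀ (by positivity)] at h3
    linarith
  refine (measure_mono hsub).trans ?_
  refine (meas_ge_le_lintegral_div (measurable_trace_contractionProduct hmeas θ N
    _).ennreal_ofReal.aemeasurable (by simp) ENNReal.ofReal_ne_top).trans ?_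
  refine (ENNReal.div_le_div_right (lintegral_trace_contractionProduct_le hmeas hint hmean hX hR
    hθ hθR k N) _).trans ?_
  rw [← ENNReal.ofReal_div_of_pos (by positivity)]
  refine ENNReal.ofReal_le_ofReal ?_
  rw [mul_div_assoc]
  refine mul_le_mul_of_nonneg_left ?_ (by positivity)
  rw [div_le_iff₀ (by positivity)]
  -- With `2 ^ k θ R ≤ 1/30` the mean decays at rate at least `12/5 * 29/30 = 2.32` per unit of `2 ^
  -- k`. Dividing by the Markov threshold `9 ^ (-2 ^ k)` costs at most `2.2`, and the surplus `0.12`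
  -- covers the claimed `1/10`.
  have h3 : Real.exp (-(11 / 5)) ≤ (1 / 3 : ℝ) ^ 2 := by
    have h1 : (1.105 : ℝ) ≤ Real.exp (1 / 10) := by
      refine le_trans ?_ (Real.quadratic_le_exp_of_nonneg (by norm_num))
      norm_num
    have h2 : (3 : ℝ) ≤ Real.exp (11 / 10) := by
      rw [show (11 / 10 : ℝ) = 1 + 1 / 10 by norm_num, Real.exp_add]
      nlinarith [Real.exp_one_gt_d9]
    rw [show (-(11 / 5) : ℝ) = -(11 / 10) + -(11 / 10) by norm_num, Real.exp_add, ← sq,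
      Real.exp_neg, one_div]
    exact pow_le_pow_left₀ (by positivity) (inv_anti₀ (by norm_num) h2) 2
  have h4 : Real.exp (-(11 / 5) * 2 ^ k) ≤ ((1 / 3 : ℝ) ^ 2) ^ 2 ^ k := by
    rw [mul_comm, show ((2 : ℝ) ^ k) = ((2 ^ k : ℕ) : ℝ) by push_cast; rfl, Real.exp_nat_mul]
    exact pow_le_pow_left₀ (Real.exp_pos _).le h3 _
  refine le_trans ?_ (mul_le_mul_of_nonneg_left h4 (Real.exp_pos _).le)
  rw [← Real.exp_add, Real.exp_le_exp]
  have h5 : 2 * 2 ^ k * θ * (1 - 2 ^ k * θ * R) * N = 12 / 5 * 2 ^ k * (1 - 2 ^ k * θ * R) := by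
    rw [hθdef]; field_simp; ring
  rw [h5]
  have h6 : (0 : ℝ) < 2 ^ k := by positivity
  nlinarith

end RandomProducts

/-! ### Posterior covariance and the variational form of the variance. -/

section KernelRidge

variable {E ι ι' : Type*} {k : E → E → ℝ} {W : Set E}

theorem IsKernelOn.symm (hk : IsKernelOn k W) {w w' : E} (hw : w ∈ W) (hw' : w' ∈ W) :
    k w w' = k w' w := by
  simpa using hk.isHermitian.apply ⟨w', hw'⟩ ⟨w, hw⟩

theorem IsKernelOn.kernelMatrix_posSemidef (hk : IsKernelOn k W) {a : ι → E}
    (ha : ∀ i, a i ∈ W) : (kernelMatrix k a a).PosSemidef :=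
  PosSemidef.submatrix hk fun i => (⟨a i, ha i⟩ : W)

theorem IsKernelOn.add_smul_one_posDef [DecidableEq ι] (hk : IsKernelOn k W)
    {a : ι → E} (ha : ∀ i, a i ∈ W) {c : ℝ} (hc : 0 < c) :
    (kernelMatrix k a a + c • (1 : Matrix ι ι ℝ)).PosDef :=
  (PosDef.one.smul hc).posSemidef_add (hk.kernelMatrix_posSemidef ha)

variable [Fintype ι] [Fintype ι']

/-- This is the squared norm of `∑ c_i k(p_i, ·) - ∑ α_j k(z_j, ·)`, written without the Hilbert
space. -/
theorem IsKernelOn.block_nonneg (hk : IsKernelOn k W) {p : ι' → E} {z : ι → E}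
    (hp : ∀ i, p i ∈ W) (hz : ∀ i, z i ∈ W) (c : ι' → ℝ) (α : ι → ℝ) :
    0 ≤ c ⬝ᵥ (kernelMatrix k p p *ᵥ c) - 2 * (α ⬝ᵥ (kernelMatrix k z p *ᵥ c)) +
      α ⬝ᵥ (kernelMatrix k z z *ᵥ α) := by
  have hpz : ∀ i, Sum.elim p z i ∈ W := by rintro (i | i) <;> simp [hp, hz]
  have h := dotProduct_mulVec_self_nonneg (hk.kernelMatrix_posSemidef hpz) (Sum.elim c (-α))
  have e : kernelMatrix k (Sum.elim p z) (Sum.elim p z) =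
      fromBlocks (kernelMatrix k p p) (kernelMatrix k p z) (kernelMatrix k z p)
        (kernelMatrix k z z) := by
    ext (i | i) (j | j) <;> rfl
  have e2 : kernelMatrix k p z = (kernelMatrix k z p)ᵀ := by
    ext i j
    exact hk.symm (hp i) (hz j)
  rw [e, fromBlocks_mulVec, sumElim_dotProduct_sumElim] at h
  have e3 : c ⬝ᵥ (kernelMatrix k p z *ᵥ α) = α ⬝ᵥ (kernelMatrix k z p *ᵥ c) := by
    rw [e2, mulVec_transpose, dotProduct_comm, ← dotProduct_mulVec]
  simp only [Sum.elim_comp_inl, Sum.elim_comp_inr, mulVec_neg, dotProduct_add, dotProduct_neg,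
    neg_dotProduct, neg_neg, e3] at h
  linarith

variable [DecidableEq ι]

/-- The posterior covariance `(k(w', w) - k_z(w)ᵀ (K_{z,z} + K τ I)⁻¹ k_z(w')) / τ`. -/
def postCov (k : E → E → ℝ) (τ : ℝ) (K : ℕ) (z : ι → E) (w w' : E) : ℝ :=
  (1 / τ) * (k w' w - (fun i => k (z i) w) ⬝ᵥ
    ((kernelMatrix k z z + ((K : ℝ) * τ) • (1 : Matrix ι ι ℝ))⁻¹ *ᵥ fun i => k (z i) w'))

theorem postCov_self (k : E → E → ℝ) (τ : ℝ) (K : ℕ) (z : ι → E) (w : E) :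
    postCov k τ K z w w = varBar k τ K z w := rfl

theorem muBar_eq_sum (k : E → E → ℝ) (τ : ℝ) (K : ℕ) (a : ι' → E) (y : ι' → ℝ) (z : ι → E)
    (w : E) : muBar k τ K a y z w = ∑ i, postCov k τ K z w (a i) * y i := by
  have h1 : kernelMatrix k z a *ᵥ y = ∑ i, y i • fun j => k (z j) (a i) := by
    funext j
    simp [mulVec, dotProduct, kernelMatrix, mul_comm]
  simp only [muBar, postCov, h1, mulVec_sum, mulVec_smul, dotProduct_sum, dotProduct_smul,
    smul_eq_mul]
  rw [dotProduct, ← Finset.sum_sub_distrib, Finset.mul_sum]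
  exact Finset.sum_congr rfl fun i _ => by ring

theorem inv_mulVec_completion {M : Matrix ι ι ℝ} (hM : M.PosDef) (b α : ι → ℝ) :
    2 * (α ⬝ᵥ b) - α ⬝ᵥ (M *ᵥ α) ≤ b ⬝ᵥ (M⁻¹ *ᵥ b) ∧
    b ⬝ᵥ (M⁻¹ *ᵥ b) = 2 * ((M⁻¹ *ᵥ b) ⬝ᵥ b) - (M⁻¹ *ᵥ b) ⬝ᵥ (M *ᵥ (M⁻¹ *ᵥ b)) := by
  have hu : M *ᵥ (M⁻¹ *ᵥ b) = b := by
    rw [mulVec_mulVec, mul_nonsing_inv _ ((isUnit_iff_isUnit_det _).1 hM.isUnit), one_mulVec]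
  have h := dotProduct_mulVec_self_nonneg hM.posSemidef (α - M⁻¹ *ᵥ b)
  simp only [mulVec_sub, sub_dotProduct, dotProduct_sub,
    dotProduct_mulVec_comm hM.posSemidef (M⁻¹ *ᵥ b) α] at h
  rw [hu, dotProduct_comm (M⁻¹ *ᵥ b) b] at *
  exact ⟨by linarith, by ring⟩

variable {τ : ℝ} {K : ℕ} {z : ι → E}

/-- The variance is the minimum over `α` of a regularised squared residual, by completing the
square. Any choice of `α` gives an upper bound; `exists_varBar_eq` provides a minimiser. -/
theorem varBar_le (hτ : 0 < τ)
    (hM : (kernelMatrix k z z + ((K : ℝ) * τ) • (1 : Matrix ι ι ℝ)).PosDef) (w : E) (α : ι → ℝ) :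
    varBar k τ K z w ≤ (1 / τ) * (k w w - 2 * (α ⬝ᵥ fun i => k (z i) w) +
      α ⬝ᵥ (kernelMatrix k z z *ᵥ α) + K * τ * (α ⬝ᵥ α)) := by
  refine mul_le_mul_of_nonneg_left ?_ (by positivity)
  have h := (inv_mulVec_completion hM (fun i => k (z i) w) α).1
  simp only [add_mulVec, smul_mulVec, one_mulVec, dotProduct_add, dotProduct_smul,
    smul_eq_mul] at h
  linarith

theorem exists_varBar_eq
    (hM : (kernelMatrix k z z + ((K : ℝ) * τ) • (1 : Matrix ι ι ℝ)).PosDef) (w : E) :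
    ∃ α : ι → ℝ, varBar k τ K z w = (1 / τ) * (k w w - 2 * (α ⬝ᵥ fun i => k (z i) w) +
      α ⬝ᵥ (kernelMatrix k z z *ᵥ α) + K * τ * (α ⬝ᵥ α)) := by
  refine ⟨(kernelMatrix k z z + ((K : ℝ) * τ) • (1 : Matrix ι ι ℝ))⁻¹ *ᵥ fun i => k (z i) w, ?_⟩
  rw [varBar, (inv_mulVec_completion hM (fun i => k (z i) w) 0).2]
  simp only [add_mulVec, smul_mulVec, one_mulVec, dotProduct_add, dotProduct_smul, smul_eq_mul]
  ring

theorem varBar_le_div (hτ : 0 < τ)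
    (hM : (kernelMatrix k z z + ((K : ℝ) * τ) • (1 : Matrix ι ι ℝ)).PosDef) (w : E) :
    varBar k τ K z w ≤ k w w / τ := by
  have h := varBar_le hτ hM w 0
  simp only [zero_dotProduct, mul_zero, sub_zero, add_zero] at h
  rwa [div_eq_inv_mul, ← one_div]

/-- With `s = ±1` this is the posterior variance of the signed sum of the evaluations at `w` and
`w'`: the block form at the ridge minimiser plus a nonnegative penalty. The two signs together bound
the covariance by the larger variance. -/
theorem IsKernelOn.postCov_polarization_nonneg (hk : IsKernelOn k W) (hτ : 0 < τ)
    (hz : ∀ i, z i ∈ W)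
    (hM : (kernelMatrix k z z + ((K : ℝ) * τ) • (1 : Matrix ι ι ℝ)).PosDef) {w w' : E}
    (hw : w ∈ W) (hw' : w' ∈ W) {s : ℝ} (hs : s ^ 2 = 1) :
    0 ≤ varBar k τ K z w + 2 * s * postCov k τ K z w w' + varBar k τ K z w' := by
  set M := kernelMatrix k z z + ((K : ℝ) * τ) • (1 : Matrix ι ι ℝ) with hMdef
  set b : ι → ℝ := fun i => k (z i) w with hb
  set b' : ι → ℝ := fun i => k (z i) w' with hb'
  have hcomm : b' ⬝ᵥ (M⁻¹ *ᵥ b) = b ⬝ᵥ (M⁻¹ *ᵥ b') := dotProduct_mulVec_comm hM.inv.posSemidef _ _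
  have h1 := (inv_mulVec_completion hM (b + s • b') 0).2
  set α := M⁻¹ *ᵥ (b + s • b') with hα
  have h2 := hk.block_nonneg (p := ![w, w']) (fun i => by fin_cases i <;> simp [hw, hw']) hz
    ![1, s] α
  have e1 : kernelMatrix k z ![w, w'] *ᵥ ![1, s] = b + s • b' := by
    funext i
    simp [mulVec, dotProduct, kernelMatrix, hb, hb', mul_comm]
  have e2 : ![1, s] ⬝ᵥ (kernelMatrix k ![w, w'] ![w, w'] *ᵥ ![1, s]) =
      k w w + 2 * s * k w' w + s ^ 2 * k w' w' := by
    simp [mulVec, dotProduct, kernelMatrix, hk.symm hw hw']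
    ring
  rw [e1, e2, hs, one_mul] at h2
  have e3 : α ⬝ᵥ (M *ᵥ α) = α ⬝ᵥ (kernelMatrix k z z *ᵥ α) + K * τ * (α ⬝ᵥ α) := by
    simp only [hMdef, add_mulVec, smul_mulVec, one_mulVec, dotProduct_add, dotProduct_smul,
      smul_eq_mul]
  have hαα : 0 ≤ α ⬝ᵥ α := by simpa using dotProduct_star_self_nonneg α
  have h3 : 0 ≤ K * τ * (α ⬝ᵥ α) := by positivity
  have e4 : (b + s • b') ⬝ᵥ α = b ⬝ᵥ (M⁻¹ *ᵥ b) + 2 * s * (b ⬝ᵥ (M⁻¹ *ᵥ b')) +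
      s ^ 2 * (b' ⬝ᵥ (M⁻¹ *ᵥ b')) := by
    rw [hα]
    simp only [mulVec_add, mulVec_smul, dotProduct_add, add_dotProduct, dotProduct_smul,
      smul_dotProduct, smul_eq_mul, hcomm]
    ring
  rw [hs, one_mul] at e4
  have e5 : varBar k τ K z w + 2 * s * postCov k τ K z w w' + varBar k τ K z w' =
      (1 / τ) * (k w w + 2 * s * k w' w + k w' w' - (b + s • b') ⬝ᵥ α) := by
    rw [e4]
    simp only [varBar, postCov, ← hMdef, ← hb, ← hb']
    ring
  rw [e5]
  refine mul_nonneg (by positivity) ?_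
  rw [h1, e3]
  linarith

theorem IsKernelOn.varBar_nonneg (hk : IsKernelOn k W) (hτ : 0 < τ)
    (hz : ∀ i, z i ∈ W)
    (hM : (kernelMatrix k z z + ((K : ℝ) * τ) • (1 : Matrix ι ι ℝ)).PosDef) {w : E}
    (hw : w ∈ W) : 0 ≤ varBar k τ K z w := by
  have h := hk.postCov_polarization_nonneg hτ hz hM hw hw (s := 1) (by norm_num)
  rw [postCov_self] at h
  linarith

theorem IsKernelOn.abs_postCov_le (hk : IsKernelOn k W) (hτ : 0 < τ)
    (hz : ∀ i, z i ∈ W)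
    (hM : (kernelMatrix k z z + ((K : ℝ) * τ) • (1 : Matrix ι ι ℝ)).PosDef) {w w' : E}
    (hw : w ∈ W) (hw' : w' ∈ W) {S : ℝ} (hS : varBar k τ K z w ≤ S) (hS' : varBar k τ K z w' ≤ S) :
    |postCov k τ K z w w'| ≤ S := by
  have h1 := hk.postCov_polarization_nonneg hτ hz hM hw hw' (s := 1) (by norm_num)
  have h2 := hk.postCov_polarization_nonneg hτ hz hM hw hw' (s := -1) (by norm_num)
  rw [abs_le]
  constructor <;> linarith

end KernelRidge

/-! ### Sensitivity of the estimator. -/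

section Sensitivity

variable {d d' : ℕ} {X : Set (EuclideanSpace ℝ (Fin d))} {C : Set (EuclideanSpace ℝ (Fin d'))}
  {k : Pt d d' → Pt d d' → ℝ}

theorem sensitivity_bound (hk : IsKernelOn k (X ×ˢ C)) (hk1 : ∀ w ∈ X ×ˢ C, k w w ≤ 1) {τ B : ℝ}
    (hτ : 0 < τ) (hB : 0 < B) {T K : ℕ} (t : Fin T) {x : Fin T → EuclideanSpace ℝ (Fin d)}
    (hx : ∀ i, x i ∈ X) {z : Fin (T * K) → Pt d d'} (hz : ∀ i, z i ∈ X ×ˢ C) :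
    BddAbove (varBar k τ K z '' (X ×ˢ C)) ∧
    BddAbove (sensitivityValues k X C τ B t x K z) ∧
    sSup (sensitivityValues k X C τ B t x K z) ≤ 2 * B * sSup (varBar k τ K z '' (X ×ˢ C)) := by
  have hM : (kernelMatrix k z z +
      ((K : ℝ) * τ) • (1 : Matrix (Fin (T * K)) (Fin (T * K)) ℝ)).PosDef := by
    -- For `K = 0` the regularisation vanishes, but the index type is empty too, so positive
    -- definiteness is vacuous.
    rcases Nat.eq_zero_or_pos K with rfl | hK
    · exact PosDef.of_dotProduct_mulVec_pos (by ext i; exact i.elim0)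
        fun {v} hv => (hv (funext fun i => i.elim0)).elim
    · exact hk.add_smul_one_posDef hz (by positivity)
  have hbdd : BddAbove (varBar k τ K z '' (X ×ˢ C)) := by
    refine ⟨1 / τ, ?_⟩
    rintro _ ⟨w, hw, rfl⟩
    exact (varBar_le_div hτ hM w).trans (div_le_div_of_nonneg_right (hk1 w hw) hτ.le)
  set S := sSup (varBar k τ K z '' (X ×ˢ C)) with hS
  have hle : ∀ w ∈ X ×ˢ C, varBar k τ K z w ≤ S := fun w hw =>
    le_csSup hbdd (Set.mem_image_of_mem _ hw)
  have hS0 : 0 ≤ S := by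
    refine Real.sSup_nonneg ?_
    rintro _ ⟨w, hw, rfl⟩
    exact hk.varBar_nonneg hτ hz hM hw
  have key : ∀ r ∈ sensitivityValues k X C τ B t x K z, r ≤ 2 * B * S := by
    rintro _ ⟨w, hw, D, D', hD, hD', hN, rfl⟩
    rw [muBar_eq_sum, muBar_eq_sum, ← Finset.sum_sub_distrib, Finset.sum_eq_single t]
    · have h1 : ∀ (A : Database d' T), A.Admissible C B →
          |postCov k τ K z w (x t, A.context t) * A.reward t| ≤ S * B := by
        intro A hA
        rw [abs_mul]
        have hp : (x t, A.context t) ∈ X ×ˢ C := ⟨hx t, hA.1 t⟩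
        exact mul_le_mul (hk.abs_postCov_le hτ hz hM hw hp (hle _ hw) (hle _ hp))
          (hA.2.1 t).le (abs_nonneg _) hS0
      have h2 := abs_sub (postCov k τ K z w (x t, D.context t) * D.reward t)
        (postCov k τ K z w (x t, D'.context t) * D'.reward t)
      linarith [h1 D hD, h1 D' hD']
    · intro i _ hi
      rw [(hN.1 i hi).1, (hN.1 i hi).2, sub_self]
    · intro h
      exact absurd (Finset.mem_univ t) h
  exact ⟨hbdd, ⟨_, key⟩, Real.sSup_le key (by positivity)⟩

end Sensitivity

/-! ### From a feature lower bound to a variance bound. -/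

section FiniteFeatures

variable {E n ι : Type*} [Fintype n] [DecidableEq n] [Fintype ι]
  {k : E → E → ℝ} {φ : E → n → ℝ}

/-- The ridge regression normal equations in a finite-dimensional feature space. -/
theorem exists_ridge_solution {τ κ : ℝ} (hτ : 0 < τ) (hκ : 0 ≤ κ) (f : ι → n → ℝ) (b : n → ℝ) :
    ∃ u : n → ℝ, b = κ • ∑ i, (u ⬝ᵥ f i) • f i + τ • u := by
  set A : Matrix n n ℝ := κ • ∑ i, vecMulVec (f i) (f i) + τ • 1 with hA
  have hApd : A.PosDef := by
    refine (PosDef.one.smul hτ).posSemidef_add ?_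
    refine PosSemidef.smul (posSemidef_sum _ fun i _ => ?_) hκ
    simpa using posSemidef_vecMulVec_self_star (f i)
  refine ⟨A⁻¹ *ᵥ b, ?_⟩
  have hu : A *ᵥ (A⁻¹ *ᵥ b) = b := by
    rw [mulVec_mulVec, mul_nonsing_inv _ ((isUnit_iff_isUnit_det _).1 hApd.isUnit), one_mulVec]
  generalize A⁻¹ *ᵥ b = u at hu
  rw [← hu, hA, add_mulVec, smul_mulVec, smul_mulVec, one_mulVec, sum_mulVec]
  congr 2
  refine Finset.sum_congr rfl fun i _ => ?_
  rw [vecMulVec_mulVec, dotProduct_comm]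
  simp

/-- The ridge solution `u` for the approximate features supplies test coefficients for `varBar_le`.
In feature space their cost is exactly `τ * (u ⬝ᵥ φ w)`; replacing the features by `k` costs `ε`
times a quadratic in the `ℓ¹` norm of the coefficients, which the same quantity controls. -/
theorem varBar_le_of_feature_lower_bound [DecidableEq ι] {τ : ℝ} (hτ : 0 < τ) {K : ℕ} (hK : 0 < K) {z : ι → E}
    (hM : (kernelMatrix k z z + ((K : ℝ) * τ) • (1 : Matrix ι ι ℝ)).PosDef) {w : E} {ε : ℝ}
    (hww : |k w w - φ w ⬝ᵥ φ w| ≤ ε) (hzw : ∀ i, |k (z i) w - φ (z i) ⬝ᵥ φ w| ≤ ε)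
    (hzz : ∀ i j, |k (z i) (z j) - φ (z i) ⬝ᵥ φ (z j)| ≤ ε) {a : n → ℝ} (ha : ∀ j, 0 < a j)
    {c : ℝ} (hc : 0 < c)
    (hlow : ∀ u : n → ℝ, c * ∑ j, a j * u j ^ 2 ≤
      (1 / K) * ∑ i, (u ⬝ᵥ φ (z i)) ^ 2 + τ * (u ⬝ᵥ u))
    {Ψ : ℝ} (hΨ : ∑ j, φ w j ^ 2 / a j ≤ Ψ) :
    varBar k τ K z w ≤ Ψ / c + 2 * ε / τ * (1 + Fintype.card ι / K * (Ψ / c)) := by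
  have hK' : (0 : ℝ) < K := by exact_mod_cast hK
  have hε : 0 ≤ ε := (abs_nonneg _).trans hww
  obtain ⟨u, hu⟩ := exists_ridge_solution hτ (κ := 1 / K) (by positivity) (fun i => φ (z i)) (φ w)
  set s := u ⬝ᵥ φ w with hs
  have hs1 : s = (1 / K) * ∑ i, (u ⬝ᵥ φ (z i)) ^ 2 + τ * (u ⬝ᵥ u) := by
    rw [hs]
    conv_lhs => rw [hu]
    simp only [dotProduct_add, dotProduct_smul, dotProduct_sum, smul_eq_mul, sq]
  have huu : 0 ≤ u ⬝ᵥ u := by simpa using dotProduct_star_self_nonneg u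
  have hs0 : 0 ≤ s := by rw [hs1]; positivity
  have hsΨ : s ≤ Ψ / c := by
    -- Weighted AM-GM. By `hlow` and `hs1` the first term is at most `s`, so one `s` cancels.
    have h1 : 2 * s ≤ c * ∑ j, a j * u j ^ 2 + (∑ j, φ w j ^ 2 / a j) / c := by
      rw [hs, dotProduct, Finset.mul_sum, Finset.mul_sum, Finset.sum_div, ← Finset.sum_add_distrib]
      refine Finset.sum_le_sum fun j _ => ?_
      have h2 : 0 ≤ (c * a j * u j - φ w j) ^ 2 / (c * a j) :=
        div_nonneg (sq_nonneg _) (mul_pos hc (ha j)).le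
      have h3 : (c * a j * u j - φ w j) ^ 2 / (c * a j) =
          c * (a j * u j ^ 2) + φ w j ^ 2 / a j / c - 2 * (u j * φ w j) := by
        have := (ha j).ne'
        field_simp
        ring
      linarith
    have h2 := hlow u
    have h3 : (∑ j, φ w j ^ 2 / a j) / c ≤ Ψ / c := div_le_div_of_nonneg_right hΨ hc.le
    linarith
  -- The normal equations make the residual `φ w - ∑ α_i φ(z_i)` equal to `τ • u`.
  set α : ι → ℝ := fun i => (1 / K) * (u ⬝ᵥ φ (z i)) with hα
  have hαα : (K : ℝ) * (α ⬝ᵥ α) = (1 / K) * ∑ i, (u ⬝ᵥ φ (z i)) ^ 2 := by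
    rw [dotProduct, Finset.mul_sum, Finset.mul_sum]
    refine Finset.sum_congr rfl fun i _ => ?_
    simp only [hα]
    generalize u ⬝ᵥ φ (z i) = r
    field_simp
  have hres : φ w - ∑ i, α i • φ (z i) = τ • u := by
    conv_lhs => rw [hu]
    simp only [hα, mul_smul, ← Finset.smul_sum]
    abel
  have hcost : φ w ⬝ᵥ φ w - 2 * ∑ i, α i * (φ (z i) ⬝ᵥ φ w) +
      ∑ i, ∑ j, α i * α j * (φ (z i) ⬝ᵥ φ (z j)) = τ ^ 2 * (u ⬝ᵥ u) := by
    have h1 : (φ w - ∑ i, α i • φ (z i)) ⬝ᵥ (φ w - ∑ i, α i • φ (z i)) = τ ^ 2 * (u ⬝ᵥ u) := by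
      rw [hres, smul_dotProduct, dotProduct_smul, smul_eq_mul, smul_eq_mul]; ring
    rw [← h1]
    simp only [sub_dotProduct, dotProduct_sub, sum_dotProduct, dotProduct_sum, smul_dotProduct,
      dotProduct_smul, smul_eq_mul, dotProduct_comm (φ w) (φ (z _))]
    have : ∑ i, ∑ j, α i * α j * (φ (z i) ⬝ᵥ φ (z j)) =
        ∑ i, α i * ∑ j, α j * (φ (z j) ⬝ᵥ φ (z i)) := by
      refine Finset.sum_congr rfl fun i _ => ?_
      rw [Finset.mul_sum]
      refine Finset.sum_congr rfl fun j _ => ?_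
      rw [dotProduct_comm (φ (z i))]; ring
    rw [this]
    simp only [mul_sub, Finset.sum_sub_distrib]
    ring
  set L := ∑ i, |α i| with hL
  have hL2 : L ^ 2 ≤ Fintype.card ι / K * s := by
    have h1 : L ^ 2 ≤ Fintype.card ι * (α ⬝ᵥ α) := by
      have := sq_sum_le_card_mul_sum_sq (s := Finset.univ) (f := fun i => |α i|)
      simpa [dotProduct, sq] using this
    have h2 : (K : ℝ) * (α ⬝ᵥ α) ≤ s := by
      rw [hαα, hs1]
      have : 0 ≤ τ * (u ⬝ᵥ u) := by positivity
      linarith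
    have h3 : α ⬝ᵥ α ≤ s / K := by rw [le_div_iff₀ hK']; linarith
    calc L ^ 2 ≤ Fintype.card ι * (α ⬝ᵥ α) := h1
      _ ≤ Fintype.card ι * (s / K) := by gcongr
      _ = _ := by ring
  have h1 : (α ⬝ᵥ fun i => k (z i) w) = ∑ i, α i * k (z i) w := rfl
  have h2 : α ⬝ᵥ (kernelMatrix k z z *ᵥ α) = ∑ i, ∑ j, α i * α j * k (z i) (z j) := by
    simp only [dotProduct, mulVec, kernelMatrix, of_apply, Finset.mul_sum]
    exact Finset.sum_congr rfl fun i _ => Finset.sum_congr rfl fun j _ => by ring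
  have h3 : -(∑ i, α i * k (z i) w) ≤ -(∑ i, α i * (φ (z i) ⬝ᵥ φ w)) + ε * L := by
    have : ∑ i, α i * (φ (z i) ⬝ᵥ φ w) - ∑ i, α i * k (z i) w ≤ ∑ i, ε * |α i| := by
      rw [← Finset.sum_sub_distrib]
      refine Finset.sum_le_sum fun i _ => ?_
      rw [← mul_sub]
      refine (le_abs_self _).trans ?_
      rw [abs_mul, mul_comm, abs_sub_comm]
      exact mul_le_mul_of_nonneg_right (hzw i) (abs_nonneg _)
    rw [← Finset.mul_sum] at this
    linarith
  have h4 : ∑ i, ∑ j, α i * α j * k (z i) (z j) ≤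
      ∑ i, ∑ j, α i * α j * (φ (z i) ⬝ᵥ φ (z j)) + ε * L ^ 2 := by
    have : ∑ i, ∑ j, α i * α j * k (z i) (z j) - ∑ i, ∑ j, α i * α j * (φ (z i) ⬝ᵥ φ (z j)) ≤
        ∑ i, ∑ j, ε * (|α i| * |α j|) := by
      rw [← Finset.sum_sub_distrib]
      refine Finset.sum_le_sum fun i _ => ?_
      rw [← Finset.sum_sub_distrib]
      refine Finset.sum_le_sum fun j _ => ?_
      rw [← mul_sub]
      refine (le_abs_self _).trans ?_
      rw [abs_mul, mul_comm, abs_mul]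
      exact mul_le_mul_of_nonneg_right (hzz i j) (by positivity)
    have e : ∑ i, ∑ j, ε * (|α i| * |α j|) = ε * L ^ 2 := by
      rw [hL, sq, Finset.sum_mul_sum, Finset.mul_sum]
      exact Finset.sum_congr rfl fun i _ => by rw [Finset.mul_sum]
    linarith
  have h5 : k w w ≤ φ w ⬝ᵥ φ w + ε := by linarith [(abs_le.1 hww).2]
  refine (varBar_le hτ hM w α).trans ?_
  rw [h1, h2]
  have h6 : k w w - 2 * ∑ i, α i * k (z i) w + ∑ i, ∑ j, α i * α j * k (z i) (z j) +
      K * τ * (α ⬝ᵥ α) ≤ τ * s + 2 * ε * (1 + L ^ 2) := by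
    have h7 : τ * s = τ ^ 2 * (u ⬝ᵥ u) + K * τ * (α ⬝ᵥ α) := by
      rw [hs1, ← hαα]; ring
    have h8 : ε * (1 + 2 * L + L ^ 2) ≤ ε * (2 * (1 + L ^ 2)) :=
      mul_le_mul_of_nonneg_left (by nlinarith [sq_nonneg (1 - L)]) hε
    linarith
  calc (1 / τ) * (k w w - 2 * ∑ i, α i * k (z i) w + ∑ i, ∑ j, α i * α j * k (z i) (z j) +
        K * τ * (α ⬝ᵥ α)) ≤ (1 / τ) * (τ * s + 2 * ε * (1 + L ^ 2)) := by gcongr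
    _ = s + 2 * ε / τ * (1 + L ^ 2) := by field_simp
    _ ≤ Ψ / c + 2 * ε / τ * (1 + Fintype.card ι / K * (Ψ / c)) := by
      gcongr
      exact hL2.trans (mul_le_mul_of_nonneg_left hsΨ (by positivity))

end FiniteFeatures

/-! ### Whitened second moments. -/

section Whitening

variable {E n : Type*} [DecidableEq n]

/-- The whitened second moment `x xᵀ + diag (1 - p)`, where `x j = √(p j) ψ j`. Its mean is the
identity if the `ψ j` are orthonormal. -/
def whitened (p : n → ℝ) (ψ : n → E → ℝ) (w : E) : Matrix n n ℝ :=
  vecMulVec (fun j => √(p j) * ψ j w) (fun j => √(p j) * ψ j w) + diagonal fun j => 1 - p j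

theorem integral_whitened [MeasurableSpace E] {μ : Measure E} {p : n → ℝ} (hp0 : ∀ j, 0 ≤ p j)
    [IsProbabilityMeasure μ] {ψ : n → E → ℝ} (hψ : ∀ j, Measurable (ψ j)) {F : ℝ}
    (hF : ∀ j w, |ψ j w| ≤ F) (horth : ∀ i j, ∫ w, ψ i w * ψ j w ∂μ = if i = j then 1 else 0)
    (i j : n) :
    Measurable (fun w => whitened p ψ w i j) ∧ Integrable (fun w => whitened p ψ w i j) μ ∧
      ∫ w, whitened p ψ w i j ∂μ = (1 : Matrix n n ℝ) i j := by
  have e : (fun w => whitened p ψ w i j) = fun w => √(p i) * √(p j) * (ψ i w * ψ j w) +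
      (diagonal fun j => 1 - p j : Matrix n n ℝ) i j := by
    funext w
    simp only [whitened, Matrix.add_apply, vecMulVec_apply]
    ring
  have hint : Integrable (fun w => ψ i w * ψ j w) μ := by
    refine Integrable.of_bound ((hψ i).mul (hψ j)).aestronglyMeasurable (F * F)
      (ae_of_all _ fun w => ?_)
    rw [Real.norm_eq_abs, abs_mul]
    exact mul_le_mul (hF i w) (hF j w) (abs_nonneg _) ((abs_nonneg _).trans (hF i w))
  rw [e]
  refine ⟨(((hψ i).mul (hψ j)).const_mul _).add_const _,
    (hint.const_mul _).add (integrable_const _), ?_⟩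
  rw [integral_add (hint.const_mul _) (integrable_const _), integral_const_mul, horth]
  by_cases hij : i = j
  · subst hij
    simp [Real.mul_self_sqrt (hp0 i)]
  · simp [hij]

variable [Fintype n]

theorem dotProduct_whitened_mulVec (p : n → ℝ) (ψ : n → E → ℝ) (w : E) (v : n → ℝ) :
    v ⬝ᵥ (whitened p ψ w *ᵥ v) =
      (v ⬝ᵥ fun j => √(p j) * ψ j w) ^ 2 + ∑ j, (1 - p j) * v j ^ 2 := by
  rw [whitened, add_mulVec, dotProduct_add, vecMulVec_mulVec, dotProduct_comm _ v]
  congr 1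
  · simp [sq]
  · simp only [dotProduct, mulVec_diagonal]
    exact Finset.sum_congr rfl fun j _ => by ring

theorem whitened_posSemidef {p : n → ℝ} (hp : ∀ j, p j ≤ 1) (ψ : n → E → ℝ) (w : E) :
    (whitened p ψ w).PosSemidef := by
  refine PosSemidef.add ?_ (PosSemidef.diagonal fun j => sub_nonneg.2 (hp j))
  simpa using posSemidef_vecMulVec_self_star fun j => √(p j) * ψ j w

theorem dotProduct_whitened_mulVec_le {p : n → ℝ} (hp0 : ∀ j, 0 ≤ p j) {ψ : n → E → ℝ}
    {F : ℝ} {w : E} (hψ : ∀ j, |ψ j w| ≤ F) (v : n → ℝ) :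
    v ⬝ᵥ (whitened p ψ w *ᵥ v) ≤ (F ^ 2 * ∑ j, p j + 1) * (v ⬝ᵥ v) := by
  rw [dotProduct_whitened_mulVec, add_mul, one_mul]
  have hvv : 0 ≤ v ⬝ᵥ v := by simpa using dotProduct_star_self_nonneg v
  refine add_le_add ?_ ?_
  · refine (dotProduct_sq_le _ _).trans ?_
    rw [mul_comm]
    refine mul_le_mul_of_nonneg_right ?_ hvv
    rw [dotProduct, Finset.mul_sum]
    refine Finset.sum_le_sum fun j _ => ?_
    have h1 : √(p j) * √(p j) = p j := Real.mul_self_sqrt (hp0 j)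
    have h2 : ψ j w ^ 2 ≤ F ^ 2 := sq_le_sq' (by linarith [(abs_le.1 (hψ j)).1]) (abs_le.1 (hψ j)).2
    calc √(p j) * ψ j w * (√(p j) * ψ j w) = (√(p j) * √(p j)) * ψ j w ^ 2 := by ring
      _ = ψ j w ^ 2 * p j := by rw [h1, mul_comm]
      _ ≤ _ := mul_le_mul_of_nonneg_right h2 (hp0 j)
  · refine Finset.sum_le_sum fun j _ => ?_
    nlinarith [hp0 j, sq_nonneg (v j)]

/-- The lower bound for whitened second moments in the original coordinates. -/
theorem feature_lower_bound_of_whitened {ι : Type*} [Fintype ι] {lam : n → ℝ}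
    (hlam : ∀ j, 0 ≤ lam j) {ψ : n → E → ℝ} {τ T K c : ℝ} (hτ : 0 < τ) (hT : 0 < T) (hK : 0 < K)
    (hcard : (Fintype.card ι : ℝ) = T * K) {z : ι → E}
    (h : ∀ v : n → ℝ, c * Fintype.card ι * (v ⬝ᵥ v) ≤
      ∑ i, v ⬝ᵥ (whitened (fun j => T * lam j / (T * lam j + τ)) ψ (z i) *ᵥ v)) (u : n → ℝ) :
    c * ∑ j, (T * lam j + τ) * u j ^ 2 ≤
      (1 / K) * ∑ i, (u ⬝ᵥ fun j => √(lam j) * ψ j (z i)) ^ 2 + τ * (u ⬝ᵥ u) := by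
  have ha : ∀ j, 0 < T * lam j + τ := fun j => by have := hlam j; positivity
  -- This scaling undoes the whitening: the diagonal term `1 - p j = τ / (T λ_j + τ)` becomes the
  -- ridge penalty `τ u·u`.
  set v : n → ℝ := fun j => √(T * lam j + τ) * u j with hv
  have h1 := h v
  have e1 : v ⬝ᵥ v = ∑ j, (T * lam j + τ) * u j ^ 2 := by
    simp only [hv, dotProduct]
    refine Finset.sum_congr rfl fun j _ => ?_
    rw [show √(T * lam j + τ) * u j * (√(T * lam j + τ) * u j) =
      (√(T * lam j + τ) * √(T * lam j + τ)) * u j ^ 2 by ring, Real.mul_self_sqrt (ha j).le]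
  have e2 : ∀ i, v ⬝ᵥ (whitened (fun j => T * lam j / (T * lam j + τ)) ψ (z i) *ᵥ v) =
      T * (u ⬝ᵥ fun j => √(lam j) * ψ j (z i)) ^ 2 + τ * (u ⬝ᵥ u) := by
    intro i
    rw [dotProduct_whitened_mulVec]
    congr 1
    · rw [← Real.sq_sqrt hT.le, ← mul_pow]
      congr 1
      simp only [hv, dotProduct, Finset.mul_sum]
      refine Finset.sum_congr rfl fun j _ => ?_
      rw [Real.sq_sqrt hT.le, Real.sqrt_div' _ (ha j).le, Real.sqrt_mul hT.le]
      have := (Real.sqrt_pos.2 (ha j)).ne'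
      field_simp
    · simp only [hv, dotProduct, Finset.mul_sum]
      refine Finset.sum_congr rfl fun j _ => ?_
      rw [mul_pow, Real.sq_sqrt (ha j).le]
      have := (ha j).ne'
      field_simp
      ring
  rw [e1] at h1
  simp only [e2, Finset.sum_add_distrib, ← Finset.mul_sum, Finset.sum_const, Finset.card_univ,
    nsmul_eq_mul, hcard] at h1
  have h2 : T * K * (c * ∑ j, (T * lam j + τ) * u j ^ 2) ≤
      T * K * ((1 / K) * ∑ i, (u ⬝ᵥ fun j => √(lam j) * ψ j (z i)) ^ 2 + τ * (u ⬝ᵥ u)) := by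
    have e3 : T * K * ((1 / K) * ∑ i, (u ⬝ᵥ fun j => √(lam j) * ψ j (z i)) ^ 2 + τ * (u ⬝ᵥ u)) =
        T * ∑ i, (u ⬝ᵥ fun j => √(lam j) * ψ j (z i)) ^ 2 + T * K * (τ * (u ⬝ᵥ u)) := by
      field_simp
    rw [e3]
    linarith
  exact le_of_mul_le_mul_left h2 (by positivity)

end Whitening

/-! ### Information gain: chain rule, boundedness, finite designs. -/

section InformationGain

variable {E : Type*} {k : E → E → ℝ} {W : Set E} {τ : ℝ}

theorem IsKernelOn.one_add_smul_posDef {ι : Type*} [DecidableEq ι] (hk : IsKernelOn k W)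
    (hτ : 0 < τ) {a : ι → E} (ha : ∀ i, a i ∈ W) : (1 + τ⁻¹ • kernelMatrix k a a).PosDef :=
  PosDef.one.add_posSemidef ((hk.kernelMatrix_posSemidef ha).smul (inv_nonneg.2 hτ.le))

theorem snoc_mem {m : ℕ} {a : Fin m → E} (ha : ∀ i, a i ∈ W) {w : E} (hw : w ∈ W)
    (i : Fin (m + 1)) : (Fin.snoc a w : Fin (m + 1) → E) i ∈ W := by
  refine Fin.lastCases ?_ (fun i => ?_) i
  · simpa using hw
  · simpa using ha i

/-- The chain rule for information gain: the Schur complement of the new diagonal entry is one plus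
the variance with `K = 1`. -/
theorem IsKernelOn.det_snoc (hk : IsKernelOn k W) (hτ : 0 < τ) {m : ℕ} {a : Fin m → E}
    (ha : ∀ i, a i ∈ W) {w : E} (hw : w ∈ W) :
    (1 + τ⁻¹ • kernelMatrix k (Fin.snoc a w : Fin (m + 1) → E) (Fin.snoc a w)).det =
      (1 + τ⁻¹ • kernelMatrix k a a).det * (1 + varBar k τ 1 a w) := by
  set A := 1 + τ⁻¹ • kernelMatrix k a a with hA
  have hApd : A.PosDef := hk.one_add_smul_posDef hτ ha
  let _ := hApd.isUnit.invertible
  set M := kernelMatrix k a a + (((1 : ℕ) : ℝ) * τ) • (1 : Matrix (Fin m) (Fin m) ℝ) with hM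
  have hMA : M = τ • A := by
    rw [hM, hA, smul_add, smul_smul, mul_inv_cancel₀ hτ.ne', one_smul, Nat.cast_one, one_mul,
      add_comm]
  have hinv : A⁻¹ = τ • M⁻¹ := by
    let _ := invertibleOfNonzero hτ.ne'
    rw [hMA, inv_smul A τ ((isUnit_iff_isUnit_det _).1 hApd.isUnit), smul_smul, mul_invOf_self,
      one_smul]
  have e : (1 + τ⁻¹ • kernelMatrix k (Fin.snoc a w : Fin (m + 1) → E) (Fin.snoc a w)).submatrix
      finSumFinEquiv finSumFinEquiv = fromBlocks A (of fun i (_ : Fin 1) => τ⁻¹ * k (a i) w)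
        (of fun (_ : Fin 1) i => τ⁻¹ * k w (a i)) (of fun _ _ => 1 + τ⁻¹ * k w w) := by
    have hs : ∀ i, (Fin.snoc a w : Fin (m + 1) → E) (Fin.castAdd 1 i) = a i := fun i =>
      Fin.snoc_castSucc (α := fun _ => E) w a i
    have hl : ∀ i : Fin 1, (Fin.snoc a w : Fin (m + 1) → E) (Fin.natAdd m i) = w := fun i => by
      have : Fin.natAdd m i = Fin.last m := by
        ext
        simp
      rw [this]
      exact Fin.snoc_last (α := fun _ => E) w a
    have hne : ∀ (i : Fin m) (j : Fin 1), Fin.castAdd 1 i ≠ Fin.natAdd m j := fun i j h => by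
      have := congrArg Fin.val h
      simp at this
      omega
    ext (i | i) (j | j)
    · simp [kernelMatrix, hA, Matrix.one_apply, hs]
    · simp [kernelMatrix, hs, hl, hne i j]
    · simp [kernelMatrix, hs, hl, (hne j i).symm]
    · simpa [kernelMatrix, Matrix.one_apply, hl] using Subsingleton.elim i j
  rw [← det_submatrix_equiv_self finSumFinEquiv, e, det_fromBlocks₁₁, det_fin_one]
  congr 1
  simp only [invOf_eq_nonsing_inv, hinv, Matrix.sub_apply, of_apply]
  have e2 : ((of fun (_ : Fin 1) i => τ⁻¹ * k w (a i)) * τ • M⁻¹ *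
      (of fun i (_ : Fin 1) => τ⁻¹ * k (a i) w)) 0 0 =
      τ⁻¹ * ((fun i => k (a i) w) ⬝ᵥ (M⁻¹ *ᵥ fun i => k (a i) w)) := by
    simp only [Matrix.mul_apply, of_apply, Matrix.smul_apply, smul_eq_mul, dotProduct, mulVec,
      Finset.mul_sum, Finset.sum_mul]
    rw [Finset.sum_comm]
    refine Finset.sum_congr rfl fun i _ => Finset.sum_congr rfl fun j _ => ?_
    rw [hk.symm hw (ha i)]
    field_simp
  rw [e2, varBar, ← hM]
  field_simp
  ring

theorem IsKernelOn.one_le_det (hk : IsKernelOn k W) (hτ : 0 < τ) {m : ℕ} (a : Fin m → E)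
    (ha : ∀ i, a i ∈ W) : 1 ≤ (1 + τ⁻¹ • kernelMatrix k a a).det := by
  induction m with
  | zero => simp
  | succ m ih =>
    have hinit : ∀ i, Fin.init a i ∈ W := fun i => ha _
    have h := hk.det_snoc hτ hinit (ha (Fin.last m))
    rw [Fin.snoc_init_self] at h
    rw [h]
    have hv : 0 ≤ varBar k τ 1 (Fin.init a) (a (Fin.last m)) :=
      hk.varBar_nonneg hτ hinit (hk.add_smul_one_posDef hinit (by simpa using hτ)) (ha _)
    nlinarith [ih _ hinit]

theorem IsKernelOn.infoGain_nonneg (hk : IsKernelOn k W) (hτ : 0 < τ) {m : ℕ} {a : Fin m → E}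
    (ha : ∀ i, a i ∈ W) : 0 ≤ infoGain k τ a :=
  mul_nonneg (by norm_num) (Real.log_nonneg (hk.one_le_det hτ a ha))

theorem IsKernelOn.maxInfoGain_nonneg (hk : IsKernelOn k W) (hτ : 0 < τ) (T : ℕ) :
    0 ≤ maxInfoGain k W τ T := by
  refine Real.sSup_nonneg ?_
  rintro _ ⟨a, ha, rfl⟩
  exact hk.infoGain_nonneg hτ ha

theorem IsKernelOn.abs_le_one (hk : IsKernelOn k W) (hk1 : ∀ w ∈ W, k w w ≤ 1) {w w' : E}
    (hw : w ∈ W) (hw' : w' ∈ W) : |k w w'| ≤ 1 := by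
  have h (s : ℝ) := hk.block_nonneg (p := ![w]) (z := ![w']) (by simpa using hw)
    (by simpa using hw') ![1] ![s]
  have h1 := h 1
  have h2 := h (-1)
  simp [kernelMatrix, mulVec, dotProduct] at h1 h2
  rw [hk.symm hw' hw] at h1 h2
  have h3 := hk1 w hw
  have h4 := hk1 w' hw'
  rw [abs_le]
  constructor <;> linarith

theorem IsKernelOn.infoGain_le_maxInfoGain (hk : IsKernelOn k W) (hk1 : ∀ w ∈ W, k w w ≤ 1)
    (hτ : 0 < τ) {T : ℕ} {a : Fin T → E} (ha : ∀ i, a i ∈ W) :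
    infoGain k τ a ≤ maxInfoGain k W τ T := by
  -- The supremum needs an upper bound; the Leibniz formula with entries of size at most `1 + τ⁻¹`
  -- is enough.
  refine le_csSup ⟨(1 / 2) * Real.log ((Fintype.card (Fin T)).factorial •
    (1 + τ⁻¹) ^ Fintype.card (Fin T)), ?_⟩ ⟨a, ha, rfl⟩
  rintro _ ⟨b, hb, rfl⟩
  have h1 := hk.one_le_det hτ b hb
  refine mul_le_mul_of_nonneg_left (Real.log_le_log (by linarith) ?_) (by norm_num)
  refine (le_abs_self _).trans (det_le (abv := AbsoluteValue.abs) fun i j => ?_)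
  have h2 := hk.abs_le_one hk1 (hb i) (hb j)
  simp only [AbsoluteValue.abs_apply, Matrix.add_apply, Matrix.smul_apply, smul_eq_mul]
  refine (abs_add_le _ _).trans (add_le_add ?_ ?_)
  · rw [Matrix.one_apply]
    split_ifs <;> simp
  · rw [abs_mul, abs_of_pos (inv_pos.2 hτ)]
    exact mul_le_of_le_one_right (inv_pos.2 hτ).le h2

/-- The old minimiser, extended by zero, remains admissible after a point is added. -/
theorem IsKernelOn.varBar_snoc_le (hk : IsKernelOn k W) (hτ : 0 < τ) {m : ℕ} {a : Fin m → E}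
    (ha : ∀ i, a i ∈ W) {w' : E} (hw' : w' ∈ W) (w : E) :
    varBar k τ 1 (Fin.snoc a w' : Fin (m + 1) → E) w ≤ varBar k τ 1 a w := by
  obtain ⟨α, hα⟩ := exists_varBar_eq (hk.add_smul_one_posDef ha
    (c := ((1 : ℕ) : ℝ) * τ) (by simpa using hτ)) w
  rw [hα]
  refine (varBar_le hτ (hk.add_smul_one_posDef (snoc_mem ha hw') (by simpa using hτ)) w
    (Fin.snoc α 0 : Fin (m + 1) → ℝ)).trans (le_of_eq ?_)
  simp [dotProduct, mulVec, kernelMatrix, Fin.sum_univ_castSucc]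

theorem varBar_comp_equiv {ι ι' : Type*} [Fintype ι] [DecidableEq ι] [Fintype ι'] [DecidableEq ι']
    (k : E → E → ℝ) (τ : ℝ) (K : ℕ) (a : ι → E) (e : ι' ≃ ι) (w : E) :
    varBar k τ K (a ∘ e) w = varBar k τ K a w := by
  have h1 : kernelMatrix k (a ∘ e) (a ∘ e) + ((K : ℝ) * τ) • (1 : Matrix ι' ι' ℝ) =
      (kernelMatrix k a a + ((K : ℝ) * τ) • (1 : Matrix ι ι ℝ)).submatrix e e := by
    ext i j
    simp [kernelMatrix, Matrix.one_apply]
  have h2 : (fun i => k ((a ∘ e) i) w) = (fun i => k (a i) w) ∘ e := rfl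
  rw [varBar, h1, inv_submatrix_equiv, h2, submatrix_mulVec_equiv, varBar, Function.comp_assoc,
    Equiv.self_comp_symm, Function.comp_id, comp_equiv_dotProduct_comp_equiv]

/-- A finite design after which the posterior variance is uniformly small. -/
theorem IsKernelOn.exists_design [TopologicalSpace E] (hk : IsKernelOn k W) (hτ : 0 < τ)
    (hW : IsCompact W) (hcont : ContinuousOn (Function.uncurry k) (W ×ˢ W)) {ε : ℝ} (hε : 0 < ε) :
    ∃ (m : ℕ) (a : Fin m → E), (∀ i, a i ∈ W) ∧ ∀ w ∈ W, varBar k τ 1 a w ≤ ε := by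
  classical
  obtain ⟨M, hM⟩ := exists_nat_gt (2 / ε)
  have hM0 : (0 : ℝ) < M := lt_trans (by positivity) hM
  have hM1 : 1 / (M : ℝ) ≤ ε / 2 := by
    rw [div_le_div_iff₀ hM0 (by norm_num)]
    rw [div_lt_iff₀ hε] at hM
    linarith
  let U : E → Set E := fun p => {w | k w w - 2 * k p w + k p p < τ * (ε / 2)}
  have hU : ∀ p ∈ W, U p ∈ nhdsWithin p W := by
    intro p hp
    have h1 : ContinuousOn (fun w => k w w - 2 * k p w + k p p) W := by
      have hd : ContinuousOn (fun w => k w w) W :=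
        hcont.comp (f := fun w => (w, w)) (by fun_prop) fun w hw => ⟨hw, hw⟩
      have hp' : ContinuousOn (fun w => k p w) W :=
        hcont.comp (f := fun w => (p, w)) (by fun_prop) fun w hw => ⟨hp, hw⟩
      exact (hd.sub (hp'.const_mul 2)).add continuousOn_const
    have h2 := h1 p hp
    refine h2.eventually (gt_mem_nhds ?_)
    have : 0 < τ * (ε / 2) := by positivity
    linarith
  obtain ⟨t, htW, ht⟩ := hW.elim_nhdsWithin_subcover U hU
  -- Each centre of the finite cover is repeated `M` times. Spreading weight one over the copies of
  -- a nearby centre costs `1 / M` in penalty, and the squared kernel distance costs at most `ε / 2`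
  -- after division by `τ`.
  let b : (t × Fin M) → E := fun i => (i.1 : E)
  have hb : ∀ i, b i ∈ W := fun i => htW _ i.1.2
  let e := (Fintype.equivFin (t × Fin M)).symm
  refine ⟨Fintype.card (t × Fin M), b ∘ e, fun i => hb _, fun w hw => ?_⟩
  rw [varBar_comp_equiv]
  obtain ⟨p, hp, hpw⟩ := Set.mem_iUnion₂.1 (ht hw)
  let α : (t × Fin M) → ℝ := fun i => if i.1 = ⟨p, hp⟩ then 1 / M else 0
  refine (varBar_le hτ (hk.add_smul_one_posDef hb (by simpa using hτ)) w α).trans ?_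
  have e1 : ∀ f : (t × Fin M) → ℝ, ∑ i, α i * f i = ∑ l, 1 / M * f (⟨p, hp⟩, l) := by
    intro f
    rw [Fintype.sum_prod_type, Finset.sum_eq_single ⟨p, hp⟩]
    · simp [α]
    · intro q _ hq
      simp [α, hq]
    · simp
  have e2 : (α ⬝ᵥ fun i => k (b i) w) = k p w := by
    rw [dotProduct, e1]
    simp [b]
    field_simp
  have e3 : α ⬝ᵥ (kernelMatrix k b b *ᵥ α) = k p p := by
    have : ∀ i, (kernelMatrix k b b *ᵥ α) i = k (b i) p := by
      intro i
      rw [mulVec, dotProduct_comm, dotProduct, e1]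
      simp [b, kernelMatrix]
      field_simp
    rw [dotProduct, e1]
    simp [this, b]
    field_simp
  have e4 : α ⬝ᵥ α = 1 / M := by
    rw [dotProduct, e1]
    simp [α]
    field_simp
  rw [e2, e3, e4]
  have h3 : k w w - 2 * k p w + k p p < τ * (ε / 2) := hpw
  calc (1 / τ) * (k w w - 2 * k p w + k p p + ((1 : ℕ) : ℝ) * τ * (1 / M))
      ≤ (1 / τ) * (τ * (ε / 2) + τ * (ε / 2)) := by
        have h4 := mul_le_mul_of_nonneg_left hM1 hτ.le
        refine mul_le_mul_of_nonneg_left ?_ (by positivity)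
        rw [Nat.cast_one, one_mul]
        linarith
    _ = ε := by field_simp; ring

end InformationGain

/-! ### The maximal information gain dominates the effective dimension. -/

section InformationGainLowerBound

variable {E n : Type*} [Fintype n] {k : E → E → ℝ} {W : Set E} {τ : ℝ}

/-- A dual lower bound for the posterior variance in terms of finitely many features. -/
theorem IsKernelOn.le_varBar_of_features (hk : IsKernelOn k W) {φ : E → n → ℝ}
    (hrem : IsKernelOn (fun w w' => k w w' - φ w ⬝ᵥ φ w') W) (hτ : 0 < τ) {m : ℕ} {a : Fin m → E}
    (ha : ∀ i, a i ∈ W) {w : E} (hw : w ∈ W) (v : n → ℝ) :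
    2 * (v ⬝ᵥ φ w) - ∑ i, (v ⬝ᵥ φ (a i)) ^ 2 - τ * (v ⬝ᵥ v) ≤ varBar k τ 1 a w := by
  obtain ⟨α, hα⟩ := exists_varBar_eq (hk.add_smul_one_posDef ha
    (c := ((1 : ℕ) : ℝ) * τ) (by simpa using hτ)) w
  -- Positivity of the remainder kernel allows it to be dropped, leaving the squared feature
  -- residual. `h2` and `h3` then bound the penalty and this residual below by expressions linear in
  -- `α` that cancel: weak duality with multiplier `v`.
  have h1 := hrem.block_nonneg (p := ![w]) (by simpa using hw) ha ![1] α
  have e1 : kernelMatrix (fun w w' => k w w' - φ w ⬝ᵥ φ w') a ![w] *ᵥ ![1] =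
      fun i => k (a i) w - φ (a i) ⬝ᵥ φ w := by
    funext i
    simp [mulVec, kernelMatrix]
  have e2 : ![(1 : ℝ)] ⬝ᵥ (kernelMatrix (fun w w' => k w w' - φ w ⬝ᵥ φ w') ![w] ![w] *ᵥ ![1]) =
      k w w - φ w ⬝ᵥ φ w := by
    simp [mulVec, dotProduct, kernelMatrix]
  have e3 : α ⬝ᵥ (kernelMatrix (fun w w' => k w w' - φ w ⬝ᵥ φ w') a a *ᵥ α) =
      α ⬝ᵥ (kernelMatrix k a a *ᵥ α) - (∑ i, α i • φ (a i)) ⬝ᵥ (∑ i, α i • φ (a i)) := by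
    have : kernelMatrix (fun w w' => k w w' - φ w ⬝ᵥ φ w') a a *ᵥ α =
        kernelMatrix k a a *ᵥ α - fun i => φ (a i) ⬝ᵥ ∑ j, α j • φ (a j) := by
      funext i
      simp only [mulVec, dotProduct_sum, dotProduct_smul, smul_eq_mul, Pi.sub_apply]
      simp only [dotProduct, kernelMatrix, of_apply, sub_mul, Finset.sum_sub_distrib]
      congr 1
      exact Finset.sum_congr rfl fun j _ => mul_comm _ _
    rw [this, dotProduct_sub]
    congr 1
    rw [sum_dotProduct, dotProduct]
    simp [smul_dotProduct]
  have e4 : (α ⬝ᵥ fun i => k (a i) w - φ (a i) ⬝ᵥ φ w) =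
      (α ⬝ᵥ fun i => k (a i) w) - (∑ i, α i • φ (a i)) ⬝ᵥ φ w := by
    rw [sum_dotProduct]
    simp [dotProduct, mul_sub, Finset.sum_sub_distrib, Finset.mul_sum, mul_assoc]
  rw [e1, e2, e3, e4] at h1
  set g := ∑ i, α i • φ (a i) with hg
  have h2 : 2 * (v ⬝ᵥ g) ≤ α ⬝ᵥ α + ∑ i, (v ⬝ᵥ φ (a i)) ^ 2 := by
    rw [hg, dotProduct_sum, dotProduct, ← Finset.sum_add_distrib, Finset.mul_sum]
    refine Finset.sum_le_sum fun i _ => ?_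
    rw [dotProduct_smul, smul_eq_mul]
    nlinarith [sq_nonneg (α i - v ⬝ᵥ φ (a i))]
  have h3 : 0 ≤ (φ w - g - τ • v) ⬝ᵥ (φ w - g - τ • v) := by
    simpa using dotProduct_star_self_nonneg (φ w - g - τ • v)
  simp only [sub_dotProduct, dotProduct_sub, smul_dotProduct, dotProduct_smul, smul_eq_mul,
    dotProduct_comm g (φ w), dotProduct_comm (φ w) v, dotProduct_comm g v] at h3 h1
  rw [hα, one_div, ← div_eq_inv_mul, le_div_iff₀ hτ, Nat.cast_one, one_mul]
  have h4 := mul_le_mul_of_nonneg_left h2 hτ.le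
  linarith

theorem integral_quadratic_form [DecidableEq n] [MeasurableSpace E] {μ : Measure E} {ψ : n → E → ℝ}
    (hint : ∀ i j, Integrable (fun w => ψ i w * ψ j w) μ)
    (horth : ∀ i j, ∫ w, ψ i w * ψ j w ∂μ = if i = j then 1 else 0) (Q : n → n → ℝ) :
    Integrable (fun w => ∑ i, ∑ j, Q i j * (ψ i w * ψ j w)) μ ∧
      ∫ w, ∑ i, ∑ j, Q i j * (ψ i w * ψ j w) ∂μ = ∑ i, Q i i := by
  refine ⟨integrable_finsetSum _ fun i _ => integrable_finsetSum _ fun j _ =>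
    (hint i j).const_mul _, ?_⟩
  rw [integral_finsetSum _ fun i _ => integrable_finsetSum _ fun j _ => (hint i j).const_mul _]
  refine Finset.sum_congr rfl fun i _ => ?_
  rw [integral_finsetSum _ fun j _ => (hint i j).const_mul _]
  simp [integral_const_mul, horth]

/-- The lower bound for the gain of `N` further points, when the accumulated squared features of
the points chosen so far are `S`. -/
def gainBound (lam : n → ℝ) (τ : ℝ) (S : n → ℝ) (N : ℕ) : ℝ :=
  N * ∑ j, lam j / (lam j * S j + N * lam j + τ)

/-- Some point does at least as well as the average over `μ`. Since `ψ j ^ 2` has mean one, a random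
point raises each `S j` by one on average while `N` falls by one, so the denominators of the
potential are preserved. Convexity of `1 / x` makes this heuristic rigorous: both the variance and
the next potential are minorised by quadratic forms in `ψ w`, whose means orthonormality gives. -/
theorem exists_point_gainBound_le [DecidableEq n] [MeasurableSpace E] {μ : Measure E}
    [IsProbabilityMeasure μ] (hμ : μ Wᶜ = 0) {lam : n → ℝ} (hlam : ∀ j, 0 ≤ lam j) {ψ : n → E → ℝ}
    (hint : ∀ i j, Integrable (fun w => ψ i w * ψ j w) μ)
    (horth : ∀ i j, ∫ w, ψ i w * ψ j w ∂μ = if i = j then 1 else 0)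
    (hk : IsKernelOn k W)
    (hrem : IsKernelOn (fun w w' => k w w' -
      (fun j => √(lam j) * ψ j w) ⬝ᵥ (fun j => √(lam j) * ψ j w')) W)
    (hτ : 0 < τ) {m : ℕ} {a : Fin m → E} (ha : ∀ i, a i ∈ W) (N : ℕ) :
    ∃ w ∈ W, gainBound lam τ (fun j => ∑ i, ψ j (a i) ^ 2) (N + 1) ≤ varBar k τ 1 a w +
      gainBound lam τ (fun j => ∑ i, ψ j (a i) ^ 2 + ψ j w ^ 2) N := by
  set S : n → ℝ := fun j => ∑ i, ψ j (a i) ^ 2 with hS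
  have hS0 : ∀ j, 0 ≤ S j := fun j => Finset.sum_nonneg fun i _ => sq_nonneg _
  let y : n → ℝ := fun j => lam j * S j + (N + 1 : ℝ) * lam j + τ
  have hy : ∀ j, 0 < y j := fun j => by
    have := hlam j; have := hS0 j; positivity
  let c : n → ℝ := fun j => 1 / y j
  have hc : ∀ j, 0 < c j := fun j => one_div_pos.2 (hy j)
  have hcy : ∀ j, c j * y j = 1 := fun j => one_div_mul_cancel (hy j).ne'
  -- The first two terms come from the dual bound with `v j = c j √(λ_j) ψ j w`, the third from the
  -- tangent bound `1 / x ≥ 2 c - x c²` for the remaining gain. `r` is the part of that tangent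
  -- bound independent of `w`.
  let q : n → ℝ := fun j => 2 * c j * lam j - τ * c j ^ 2 * lam j - N * lam j ^ 2 * c j ^ 2
  let Q : n → n → ℝ := fun i j => (if i = j then q i else 0) -
    ∑ l, (c i * lam i * ψ i (a l)) * (c j * lam j * ψ j (a l))
  let r : ℝ := N * ∑ j, lam j * (2 * c j - (lam j * S j + N * lam j + τ) * c j ^ 2)
  obtain ⟨hQi, hQ⟩ := integral_quadratic_form hint horth Q
  obtain ⟨w, hw, hle⟩ := exists_notMem_null_integral_le
    (f := fun w => ∑ i, ∑ j, Q i j * (ψ i w * ψ j w) + r) (hQi.add (integrable_const r)) hμ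
  have hw : w ∈ W := by simpa using hw
  refine ⟨w, hw, ?_⟩
  rw [integral_add hQi (integrable_const r), hQ, integral_const, probReal_univ, one_smul] at hle
  have h1 : gainBound lam τ S (N + 1) ≤ ∑ i, Q i i + r := by
    simp only [gainBound, r, Finset.mul_sum, ← Finset.sum_add_distrib]
    refine Finset.sum_le_sum fun j _ => ?_
    have e1 : Q j j = q j - c j ^ 2 * lam j ^ 2 * S j := by
      simp only [Q, if_true, hS, Finset.mul_sum]
      congr 1
      exact Finset.sum_congr rfl fun l _ => by ring
    have e2 : lam j / (lam j * S j + ((N + 1 : ℕ) : ℝ) * lam j + τ) = lam j * c j := by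
      simp only [c, y]; push_cast; ring
    rw [e1, e2]
    simp only [q]
    push_cast
    have h2 : c j * (lam j * S j + τ) ≤ 1 := by
      rw [← hcy j]
      refine mul_le_mul_of_nonneg_left ?_ (hc j).le
      have : 0 ≤ (N + 1 : ℝ) * lam j := by have := hlam j; positivity
      simp only [y]; linarith
    have h3 : lam j * c j * (c j * (lam j * S j + τ)) ≤ lam j * c j * 1 :=
      mul_le_mul_of_nonneg_left h2 (mul_nonneg (hlam j) (hc j).le)
    have h4 : (N : ℝ) * lam j * c j * (c j * y j) = N * lam j * c j := by rw [hcy, mul_one]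
    simp only [y] at h4
    linarith
  refine h1.trans (hle.trans ?_)
  have h2 := hk.le_varBar_of_features hrem hτ ha hw fun j => c j * (√(lam j) * ψ j w)
  have hsq : ∀ j, √(lam j) * √(lam j) = lam j := fun j => Real.mul_self_sqrt (hlam j)
  have e3 : ∀ l, (fun j => c j * (√(lam j) * ψ j w)) ⬝ᵥ (fun j => √(lam j) * ψ j (a l)) =
      ∑ j, (c j * lam j * ψ j (a l)) * ψ j w := by
    intro l
    refine Finset.sum_congr rfl fun j _ => ?_
    calc c j * (√(lam j) * ψ j w) * (√(lam j) * ψ j (a l)) =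
        c j * (√(lam j) * √(lam j)) * ψ j (a l) * ψ j w := by ring
      _ = _ := by rw [hsq]
  have e4 : (fun j => c j * (√(lam j) * ψ j w)) ⬝ᵥ (fun j => √(lam j) * ψ j w) =
      ∑ j, c j * lam j * ψ j w ^ 2 := by
    refine Finset.sum_congr rfl fun j _ => ?_
    calc c j * (√(lam j) * ψ j w) * (√(lam j) * ψ j w) =
        c j * (√(lam j) * √(lam j)) * ψ j w ^ 2 := by ring
      _ = _ := by rw [hsq]
  have e5 : (fun j => c j * (√(lam j) * ψ j w)) ⬝ᵥ (fun j => c j * (√(lam j) * ψ j w)) =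
      ∑ j, c j ^ 2 * lam j * ψ j w ^ 2 := by
    refine Finset.sum_congr rfl fun j _ => ?_
    calc c j * (√(lam j) * ψ j w) * (c j * (√(lam j) * ψ j w)) =
        c j ^ 2 * (√(lam j) * √(lam j)) * ψ j w ^ 2 := by ring
      _ = _ := by rw [hsq]
  simp only [e3, e4, e5] at h2
  have e6 : ∑ i, ∑ j, Q i j * (ψ i w * ψ j w) = ∑ j, q j * ψ j w ^ 2 -
      ∑ l, (∑ j, (c j * lam j * ψ j (a l)) * ψ j w) ^ 2 := by
    have : ∀ l, (∑ j, (c j * lam j * ψ j (a l)) * ψ j w) ^ 2 = ∑ i, ∑ j,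
        ((c i * lam i * ψ i (a l)) * (c j * lam j * ψ j (a l))) * (ψ i w * ψ j w) := by
      intro l
      rw [sq, Finset.sum_mul_sum]
      exact Finset.sum_congr rfl fun i _ => Finset.sum_congr rfl fun j _ => by ring
    simp only [this]
    conv_rhs => rw [Finset.sum_comm, ← Finset.sum_sub_distrib]
    refine Finset.sum_congr rfl fun i _ => ?_
    rw [Finset.sum_comm]
    simp only [Q, sub_mul, Finset.sum_sub_distrib, Finset.sum_mul]
    congr 1
    simp [ite_mul, sq]
  have h3 : r - N * ∑ j, lam j ^ 2 * c j ^ 2 * ψ j w ^ 2 ≤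
      gainBound lam τ (fun j => S j + ψ j w ^ 2) N := by
    simp only [gainBound, r]
    rw [← mul_sub, ← Finset.sum_sub_distrib]
    refine mul_le_mul_of_nonneg_left (Finset.sum_le_sum fun j _ => ?_) (Nat.cast_nonneg N)
    set x := lam j * (S j + ψ j w ^ 2) + N * lam j + τ with hx
    have hxpos : 0 < x := by have := hlam j; have := hS0 j; positivity
    have h4 : 2 * c j - x * c j ^ 2 ≤ 1 / x := by
      rw [le_div_iff₀ hxpos]
      nlinarith [sq_nonneg (c j * x - 1)]
    have h5 := mul_le_mul_of_nonneg_left h4 (hlam j)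
    rw [mul_one_div (lam j) x] at h5
    refine le_trans (le_of_eq ?_) h5
    rw [hx]
    ring
  rw [e6]
  have e7 : ∑ j, q j * ψ j w ^ 2 = 2 * ∑ j, c j * lam j * ψ j w ^ 2 -
      τ * ∑ j, c j ^ 2 * lam j * ψ j w ^ 2 - N * ∑ j, lam j ^ 2 * c j ^ 2 * ψ j w ^ 2 := by
    simp only [Finset.mul_sum, ← Finset.sum_sub_distrib]
    exact Finset.sum_congr rfl fun j _ => by simp only [q]; ring
  rw [e7]
  linarith

/-- A potential argument: `log (1 + v) ≥ v / (1 + v) ≥ v / (1 + ε)`, since added points never raise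
the variance above `ε`. Each step therefore increases the log determinant by at least the loss of
potential divided by `1 + ε`. -/
theorem exists_extension_log_det [DecidableEq n] [MeasurableSpace E] {μ : Measure E}
    [IsProbabilityMeasure μ] (hμ : μ Wᶜ = 0) {lam : n → ℝ} (hlam : ∀ j, 0 ≤ lam j) {ψ : n → E → ℝ}
    (hint : ∀ i j, Integrable (fun w => ψ i w * ψ j w) μ)
    (horth : ∀ i j, ∫ w, ψ i w * ψ j w ∂μ = if i = j then 1 else 0)
    (hk : IsKernelOn k W)
    (hrem : IsKernelOn (fun w w' => k w w' -
      (fun j => √(lam j) * ψ j w) ⬝ᵥ (fun j => √(lam j) * ψ j w')) W)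
    (hτ : 0 < τ) {ε : ℝ} (hε : 0 < ε) (N : ℕ) {m T : ℕ} (hT : T = m + N) {a : Fin m → E}
    (ha : ∀ i, a i ∈ W) (hvar : ∀ w ∈ W, varBar k τ 1 a w ≤ ε) :
    ∃ b : Fin T → E, (∀ i, b i ∈ W) ∧ Real.log (1 + τ⁻¹ • kernelMatrix k a a).det +
      gainBound lam τ (fun j => ∑ i, ψ j (a i) ^ 2) N / (1 + ε) ≤
        Real.log (1 + τ⁻¹ • kernelMatrix k b b).det := by
  induction N generalizing m with
  | zero =>
    subst hT
    exact ⟨a, ha, by simp [gainBound]⟩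
  | succ N ih =>
    obtain ⟨w, hw, hle⟩ := exists_point_gainBound_le hμ hlam hint horth hk hrem hτ ha N
    obtain ⟨b, hb, hble⟩ := ih (m := m + 1) (by omega) (snoc_mem ha hw)
      fun w' hw' => (hk.varBar_snoc_le hτ ha hw w').trans (hvar w' hw')
    refine ⟨b, hb, le_trans ?_ hble⟩
    have hv0 : 0 ≤ varBar k τ 1 a w :=
      hk.varBar_nonneg hτ ha (hk.add_smul_one_posDef ha (by simpa using hτ)) hw
    have hd := hk.one_le_det hτ a ha
    rw [hk.det_snoc hτ ha hw, Real.log_mul (by linarith) (by linarith)]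
    have e : (fun j => ∑ i : Fin (m + 1), ψ j ((Fin.snoc a w : Fin (m + 1) → E) i) ^ 2) =
        fun j => ∑ i, ψ j (a i) ^ 2 + ψ j w ^ 2 := by
      funext j
      simp [Fin.sum_univ_castSucc]
    rw [e]
    have h1 : varBar k τ 1 a w / (1 + ε) ≤ Real.log (1 + varBar k τ 1 a w) := by
      have h2 := Real.one_sub_inv_le_log_of_pos (x := 1 + varBar k τ 1 a w) (by linarith)
      have h3 : 1 - (1 + varBar k τ 1 a w)⁻¹ = varBar k τ 1 a w / (1 + varBar k τ 1 a w) := by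
        field_simp
        ring
      rw [h3] at h2
      refine le_trans ?_ h2
      exact div_le_div_of_nonneg_left hv0 (by linarith) (by linarith [hvar w hw])
    have h2 := div_le_div_of_nonneg_right hle (show (0 : ℝ) ≤ 1 + ε by linarith)
    rw [add_div] at h2
    linarith

/-- The effective dimension `∑ j, T λ_j / (T λ_j + τ)` of finitely many eigenvalues. -/
def effectiveDim (lam : n → ℝ) (τ T : ℝ) : ℝ := ∑ j, T * lam j / (T * lam j + τ)

theorem effectiveDim_le_maxInfoGain [DecidableEq n] [MeasurableSpace E] {μ : Measure E}
    [IsProbabilityMeasure μ] (hμ : μ Wᶜ = 0) {lam : n → ℝ} (hlam : ∀ j, 0 ≤ lam j) {ψ : n → E → ℝ}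
    (hint : ∀ i j, Integrable (fun w => ψ i w * ψ j w) μ)
    (horth : ∀ i j, ∫ w, ψ i w * ψ j w ∂μ = if i = j then 1 else 0)
    {F : ℝ} (hF : ∀ j w, |ψ j w| ≤ F) (hk : IsKernelOn k W) (hk1 : ∀ w ∈ W, k w w ≤ 1)
    (hrem : IsKernelOn (fun w w' => k w w' -
      (fun j => √(lam j) * ψ j w) ⬝ᵥ (fun j => √(lam j) * ψ j w')) W)
    (hτ : 0 < τ) {m : ℕ} {a : Fin m → E} (ha : ∀ i, a i ∈ W)
    (hvar : ∀ w ∈ W, varBar k τ 1 a w ≤ 1 / 40) {T : ℕ} (hT0 : 0 < T)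
    (hT : 50 * (m * (1 + F ^ 2)) ≤ T) :
    19 / 40 * effectiveDim lam τ T ≤ maxInfoGain k W τ T := by
  have hT0' : (0 : ℝ) < T := by exact_mod_cast hT0
  have hmF : 0 ≤ m * F ^ 2 := by positivity
  have hmT : m ≤ T := by
    have : (m : ℝ) ≤ T := by
      have : (0 : ℝ) ≤ m := Nat.cast_nonneg m
      nlinarith
    exact_mod_cast this
  obtain ⟨N, rfl⟩ := Nat.exists_eq_add_of_le hmT
  obtain ⟨b, hb, hle⟩ := exists_extension_log_det hμ hlam hint horth hk hrem hτ
    (by norm_num : (0 : ℝ) < 1 / 40) N rfl ha hvar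
  refine le_trans ?_ (hk.infoGain_le_maxInfoGain hk1 hτ hb)
  rw [infoGain]
  have hlog : 0 ≤ Real.log (1 + τ⁻¹ • kernelMatrix k a a).det :=
    Real.log_nonneg (hk.one_le_det hτ a ha)
  set T : ℝ := ((m + N : ℕ) : ℝ) with hTdef
  have hTN : T = m + N := by rw [hTdef]; push_cast; ring
  -- The design uses at most a fiftieth of the budget, including its accumulated features `S ≤ m
  -- F²`. Overall, `1/2 * 49/50 / (1 + 1/40) = 98/205 ≥ 19/40`.
  have hgain : 49 / 50 * effectiveDim lam τ T ≤
      gainBound lam τ (fun j => ∑ i, ψ j (a i) ^ 2) N := by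
    rw [effectiveDim, gainBound, Finset.mul_sum, Finset.mul_sum]
    refine Finset.sum_le_sum fun j _ => ?_
    have hl := hlam j
    have hS0 : 0 ≤ ∑ i, ψ j (a i) ^ 2 := Finset.sum_nonneg fun i _ => sq_nonneg _
    have hS : ∑ i, ψ j (a i) ^ 2 ≤ m * F ^ 2 := by
      have : ∑ i, ψ j (a i) ^ 2 ≤ ∑ _i : Fin m, F ^ 2 := Finset.sum_le_sum fun i _ =>
        sq_le_sq' (by linarith [(abs_le.1 (hF j (a i))).1]) (abs_le.1 (hF j (a i))).2
      simpa using this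
    set S := ∑ i, ψ j (a i) ^ 2
    have hA : 49 / 50 * (T + m * F ^ 2) ≤ N := by linarith
    have hx : 0 < lam j * S + N * lam j + τ := by positivity
    have hy : 0 < T * lam j + τ := by positivity
    rw [← mul_div_assoc, ← mul_div_assoc, div_le_div_iff₀ hy hx]
    have h1 : 49 / 50 * (S + N) ≤ N := by
      have : (0 : ℝ) ≤ m := Nat.cast_nonneg m
      linarith
    have h2 : 49 / 50 * T ≤ N := by linarith
    have h3 : T * lam j ^ 2 * (49 / 50 * (S + N)) ≤ T * lam j ^ 2 * N :=
      mul_le_mul_of_nonneg_left h1 (by positivity)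
    have h4 : lam j * τ * (49 / 50 * T) ≤ lam j * τ * N :=
      mul_le_mul_of_nonneg_left h2 (by positivity)
    nlinarith
  have hd : 0 ≤ effectiveDim lam τ T :=
    Finset.sum_nonneg fun j _ => by have := hlam j; positivity
  have h5 := div_le_div_of_nonneg_right hgain (show (0 : ℝ) ≤ 1 + 1 / 40 by norm_num)
  have h6 : 49 / 50 * effectiveDim lam τ T / (1 + 1 / 40) = 196 / 205 * effectiveDim lam τ T := by
    ring
  rw [h6] at h5
  linarith

end InformationGainLowerBound

/-! ### Truncation of the Mercer series. -/

section Truncation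

variable {E : Type*} {k : E → E → ℝ} {W : Set E} {lam : ℕ → ℝ} {ψ : ℕ → E → ℝ}

/-- The first `D` Mercer features. -/
def mercerFeature (lam : ℕ → ℝ) (ψ : ℕ → E → ℝ) (D : ℕ) (w : E) : Fin D → ℝ :=
  fun j => √(lam j) * ψ j w

theorem mercerFeature_dotProduct (hlam : ∀ j, 0 ≤ lam j) (D : ℕ) (w w' : E) :
    mercerFeature lam ψ D w ⬝ᵥ mercerFeature lam ψ D w' =
      ∑ j ∈ Finset.range D, lam j * ψ j w * ψ j w' := by
  rw [← Fin.sum_univ_eq_sum_range (fun j => lam j * ψ j w * ψ j w')]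
  refine Finset.sum_congr rfl fun j _ => ?_
  calc √(lam j) * ψ j w * (√(lam j) * ψ j w') = (√(lam j) * √(lam j)) * ψ j w * ψ j w' := by ring
    _ = _ := by rw [Real.mul_self_sqrt (hlam j)]

theorem hasSum_remainder (hlam : ∀ j, 0 ≤ lam j)
    (hsum : ∀ w ∈ W, ∀ w' ∈ W, HasSum (fun j => lam j * ψ j w * ψ j w') (k w w')) (D : ℕ)
    {w w' : E} (hw : w ∈ W) (hw' : w' ∈ W) :
    HasSum (fun j => lam (j + D) * ψ (j + D) w * ψ (j + D) w')
      (k w w' - mercerFeature lam ψ D w ⬝ᵥ mercerFeature lam ψ D w') := by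
  rw [mercerFeature_dotProduct hlam]
  exact (hasSum_nat_add_iff' D).2 (hsum w hw w' hw')

/-- The tail of the series is a pointwise limit of nonnegative combinations of rank-one kernels. -/
theorem isKernelOn_remainder (hk : IsKernelOn k W) (hlam : ∀ j, 0 ≤ lam j)
    (hsum : ∀ w ∈ W, ∀ w' ∈ W, HasSum (fun j => lam j * ψ j w * ψ j w') (k w w')) (D : ℕ) :
    IsKernelOn (fun w w' => k w w' - mercerFeature lam ψ D w ⬝ᵥ mercerFeature lam ψ D w') W := by
  refine ⟨?_, fun x => ?_⟩
  · ext w w'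
    simp only [conjTranspose_apply, of_apply, star_trivial]
    rw [hk.symm w'.2 w.2, dotProduct_comm]
  · have h : HasSum (fun l => x.sum fun i xi => x.sum fun j xj =>
        xi * (lam (l + D) * ψ (l + D) i * ψ (l + D) j) * xj)
        (x.sum fun i xi => x.sum fun j xj => star xi *
          (of fun w w' : W => k w w' - mercerFeature lam ψ D w ⬝ᵥ mercerFeature lam ψ D w') i j *
            xj) := by
      refine hasSum_sum fun i _ => hasSum_sum fun j _ => ?_
      exact ((hasSum_remainder hlam hsum D i.2 j.2).mul_left _).mul_right _
    refine h.nonneg fun l => ?_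
    have e : (x.sum fun i xi => x.sum fun j xj =>
        xi * (lam (l + D) * ψ (l + D) i * ψ (l + D) j) * xj) =
        lam (l + D) * (x.sum fun i xi => xi * ψ (l + D) i) ^ 2 := by
      simp only [Finsupp.sum]
      rw [sq, Finset.sum_mul_sum, Finset.mul_sum]
      refine Finset.sum_congr rfl fun i _ => ?_
      rw [Finset.mul_sum]
      exact Finset.sum_congr rfl fun j _ => by ring
    rw [e]
    exact mul_nonneg (hlam _) (sq_nonneg _)

theorem abs_remainder_le (hlam : ∀ j, 0 ≤ lam j)
    (hsum : ∀ w ∈ W, ∀ w' ∈ W, HasSum (fun j => lam j * ψ j w * ψ j w') (k w w'))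
    {F : ℝ} (hF : ∀ j w, |ψ j w| ≤ F) {D : ℕ} {ε : ℝ}
    (hε : HasSum (fun j => lam (j + D)) ε) {w w' : E} (hw : w ∈ W) (hw' : w' ∈ W) :
    |k w w' - mercerFeature lam ψ D w ⬝ᵥ mercerFeature lam ψ D w'| ≤ F ^ 2 * ε := by
  have h := hasSum_remainder hlam hsum D hw hw'
  have hb := hε.mul_left (F ^ 2)
  have hle : ∀ j, |lam (j + D) * ψ (j + D) w * ψ (j + D) w'| ≤ F ^ 2 * lam (j + D) := by
    intro j
    rw [abs_mul, abs_mul, abs_of_nonneg (hlam _), mul_assoc, mul_comm, sq]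
    refine mul_le_mul_of_nonneg_right ?_ (hlam _)
    exact mul_le_mul (hF _ _) (hF _ _) (abs_nonneg _) ((abs_nonneg _).trans (hF 0 w))
  rw [abs_le]
  exact ⟨by simpa using hasSum_le (fun j => (abs_le.1 (hle j)).1) hb.neg h,
    hasSum_le (fun j => (abs_le.1 (hle j)).2) h hb⟩

end Truncation

/-! ### Consequences of polynomial eigendecay. -/

section Eigendecay

variable {lam : ℕ → ℝ} {Cp βp : ℝ}

theorem summable_decay (hβp : 1 < βp) :
    Summable fun j : ℕ => ((j : ℝ) + 1) ^ (-((βp + 1) / 2)) := by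
  have h := (Real.summable_nat_rpow (p := -((βp + 1) / 2))).2 (by linarith)
  have := (summable_nat_add_iff 1).2 h
  simpa using this

/-- The exponent `βp` splits into `(βp - 1) / 2` and `(βp + 1) / 2`. Beyond index `T ^ m` the first
part yields `T ^ (-2)`, while the second exceeds one and stays summable. -/
theorem PolynomialEigendecay.exists_tail_le (hdecay : PolynomialEigendecay lam Cp βp)
    (hlam : ∀ j, 0 ≤ lam j) (hCp : 0 < Cp) (hβp : 1 < βp) {m : ℕ} (hm : 2 ≤ m * ((βp - 1) / 2))
    {T : ℕ} (hT : 0 < T) :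
    ∃ ε : ℝ, HasSum (fun j => lam (j + T ^ m)) ε ∧
      ε ≤ Cp * (∑' j : ℕ, ((j : ℝ) + 1) ^ (-((βp + 1) / 2))) / T ^ 2 := by
  have hT' : (1 : ℝ) ≤ T := by exact_mod_cast hT
  have hs := (summable_decay hβp).hasSum.mul_left (Cp / (T : ℝ) ^ 2)
  have hle : ∀ j, lam (j + T ^ m) ≤ Cp / (T : ℝ) ^ 2 * ((j : ℝ) + 1) ^ (-((βp + 1) / 2)) := by
    intro j
    refine (hdecay _).trans ?_
    have hj : (0 : ℝ) ≤ j := Nat.cast_nonneg j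
    have hTm : (0 : ℝ) < (T : ℝ) ^ m := by positivity
    push_cast
    rw [show -βp = -((βp - 1) / 2) + -((βp + 1) / 2) by ring, Real.rpow_add (by positivity),
      div_mul_eq_mul_div, mul_div_assoc]
    refine mul_le_mul_of_nonneg_left ?_ hCp.le
    have h1 : ((j : ℝ) + T ^ m + 1) ^ (-((βp - 1) / 2)) ≤ 1 / (T : ℝ) ^ 2 := by
      calc ((j : ℝ) + T ^ m + 1) ^ (-((βp - 1) / 2)) ≤ ((T : ℝ) ^ m) ^ (-((βp - 1) / 2)) :=
            Real.rpow_le_rpow_of_nonpos hTm (by linarith) (by linarith)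
        _ = (T : ℝ) ^ (-(m * ((βp - 1) / 2))) := by
            rw [← Real.rpow_natCast, ← Real.rpow_mul (by positivity)]
            ring_nf
        _ ≤ (T : ℝ) ^ (-(2 : ℝ)) := Real.rpow_le_rpow_of_exponent_le hT' (by linarith)
        _ = 1 / (T : ℝ) ^ 2 := by
            rw [Real.rpow_neg (by positivity), one_div]
            norm_num
    have h2 : ((j : ℝ) + T ^ m + 1) ^ (-((βp + 1) / 2)) ≤ ((j : ℝ) + 1) ^ (-((βp + 1) / 2)) :=
      Real.rpow_le_rpow_of_nonpos (by positivity) (by linarith) (by linarith)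
    calc _ ≤ 1 / (T : ℝ) ^ 2 * ((j : ℝ) + 1) ^ (-((βp + 1) / 2)) :=
          mul_le_mul h1 h2 (by positivity) (by positivity)
      _ = _ := by ring
  have hsum : Summable fun j => lam (j + T ^ m) :=
    Summable.of_nonneg_of_le (fun j => hlam _) hle hs.summable
  refine ⟨_, hsum.hasSum, ?_⟩
  refine (hasSum_le hle hsum.hasSum hs).trans (le_of_eq (by ring))

/-- For `0 ≤ a ≤ 1`, `x / (x + τ) ≤ min 1 (x / τ) ≤ (x / τ) ^ a`. The choice of `a` makes `βp * a =
(βp + 1) / 2 > 1`, so the sum converges, while `a < 1` keeps the growth in `T` sublinear. -/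
theorem PolynomialEigendecay.effectiveDim_le (hdecay : PolynomialEigendecay lam Cp βp)
    (hlam : ∀ j, 0 ≤ lam j) (hCp : 0 < Cp) (hβp : 1 < βp) {τ : ℝ} (hτ : 0 < τ) {T : ℝ}
    (hT : 0 < T) (D : ℕ) :
    effectiveDim (fun j : Fin D => lam j) τ T ≤
      (Cp / τ) ^ ((βp + 1) / 2 / βp) * (∑' j : ℕ, ((j : ℝ) + 1) ^ (-((βp + 1) / 2))) *
        T ^ ((βp + 1) / 2 / βp) := by
  set a := (βp + 1) / 2 / βp with ha
  have hβ0 : 0 < βp := by linarith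
  have ha0 : 0 ≤ a := by positivity
  have ha1 : a ≤ 1 := by rw [ha, div_le_one hβ0]; linarith
  have haβ : βp * a = (βp + 1) / 2 := by rw [ha]; field_simp
  have hle : ∀ j : ℕ, T * lam j / (T * lam j + τ) ≤
      (Cp / τ) ^ a * T ^ a * ((j : ℝ) + 1) ^ (-((βp + 1) / 2)) := by
    intro j
    have hl := hlam j
    have hx : 0 ≤ T * lam j := by positivity
    have h1 : T * lam j / (T * lam j + τ) ≤ (T * lam j / τ) ^ a := by
      rcases le_total (T * lam j / τ) 1 with h | h
      · calc T * lam j / (T * lam j + τ) ≤ T * lam j / τ :=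
              div_le_div_of_nonneg_left hx hτ (by linarith)
          _ = (T * lam j / τ) ^ (1 : ℝ) := (Real.rpow_one _).symm
          _ ≤ (T * lam j / τ) ^ a := by
              rcases (div_nonneg hx hτ.le).eq_or_lt with h0 | h0
              · rw [← h0, Real.zero_rpow one_ne_zero]
                exact Real.rpow_nonneg le_rfl _
              · exact Real.rpow_le_rpow_of_exponent_ge h0 h ha1
      · calc T * lam j / (T * lam j + τ) ≤ 1 := (div_le_one (by positivity)).2 (by linarith)
          _ ≤ _ := Real.one_le_rpow h ha0
    refine h1.trans ?_
    have h2 : T * lam j / τ ≤ Cp / τ * T * ((j : ℝ) + 1) ^ (-βp) := by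
      calc T * lam j / τ ≤ T * (Cp * ((j : ℝ) + 1) ^ (-βp)) / τ := by
            have := hdecay j
            gcongr
        _ = _ := by ring
    refine (Real.rpow_le_rpow (by positivity) h2 ha0).trans (le_of_eq ?_)
    rw [Real.mul_rpow (by positivity) (by positivity), Real.mul_rpow (by positivity) (by positivity),
      ← Real.rpow_mul (by positivity), neg_mul, haβ]
  have hs := (summable_decay hβp).mul_left ((Cp / τ) ^ a * T ^ a)
  calc effectiveDim (fun j : Fin D => lam j) τ T
      = ∑ j ∈ Finset.range D, T * lam j / (T * lam j + τ) :=
        Fin.sum_univ_eq_sum_range (fun j => T * lam j / (T * lam j + τ)) D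
    _ ≤ ∑ j ∈ Finset.range D, (Cp / τ) ^ a * T ^ a * ((j : ℝ) + 1) ^ (-((βp + 1) / 2)) :=
        Finset.sum_le_sum fun j _ => hle j
    _ ≤ ∑' j : ℕ, (Cp / τ) ^ a * T ^ a * ((j : ℝ) + 1) ^ (-((βp + 1) / 2)) :=
        hs.sum_le_tsum _ fun j _ => by positivity
    _ = _ := by rw [tsum_mul_left]; ring

/-- For large `T` there is a dyadic exponent for which the matrix Chernoff bound applies in
dimension `T ^ m` with radius `A * T ^ a`, `a < 1`. -/
theorem eventually_exists_dyadic_exponent {A a δ : ℝ} (hA : 0 < A) (ha : a < 1) (hδ : 0 < δ)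
    (m : ℕ) : ∀ᶠ T : ℕ in Filter.atTop, ∃ l : ℕ, 2 ^ l * (A * (T : ℝ) ^ a) * 36 ≤ T ∧
      ((T ^ m : ℕ) : ℝ) * Real.exp (-(2 ^ l / 10)) ≤ δ := by
  set b := (1 - a) / 2 with hb
  have hb0 : 0 < b := by rw [hb]; linarith
  have hlim : Filter.Tendsto (fun T : ℕ => (T : ℝ) ^ b) Filter.atTop Filter.atTop :=
    (tendsto_rpow_atTop hb0).comp tendsto_natCast_atTop_atTop
  -- `2 ^ l` is taken within a factor two below `T ^ b`, which turns the rate `1 / 10` into `1 /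
  -- 20`. As `2 b + a = 1`, a spare factor `T ^ b` absorbs `36 A`, and `exp (-T ^ b / 20)` beats `T
  -- ^ m`.
  have h1 := hlim.eventually_ge_atTop (36 * A)
  have h2 := ((tendsto_rpow_mul_exp_neg_mul_atTop_nhds_zero (m / b) (1 / 20)
    (by norm_num)).comp hlim).eventually (ge_mem_nhds hδ)
  filter_upwards [h1, h2, Filter.eventually_ge_atTop 1] with T h1 h2 hT
  have hT' : (1 : ℝ) ≤ T := by exact_mod_cast hT
  have hT0 : (0 : ℝ) < T := by linarith
  obtain ⟨l, hl1, hl2⟩ := exists_nat_pow_near (Real.one_le_rpow hT' hb0.le)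
    (by norm_num : (1 : ℝ) < 2)
  refine ⟨l, ?_, ?_⟩
  · calc 2 ^ l * (A * (T : ℝ) ^ a) * 36 ≤ (T : ℝ) ^ b * (A * (T : ℝ) ^ a) * 36 := by gcongr
      _ = (36 * A) * ((T : ℝ) ^ b * (T : ℝ) ^ a) := by ring
      _ ≤ (T : ℝ) ^ b * ((T : ℝ) ^ b * (T : ℝ) ^ a) := by gcongr
      _ = T := by
          rw [← Real.rpow_add hT0, ← Real.rpow_add hT0, show b + (b + a) = 1 by rw [hb]; ring,
            Real.rpow_one]
  · simp only [Function.comp_apply] at h2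
    rw [← Real.rpow_mul hT0.le, mul_div_cancel₀ _ hb0.ne', Real.rpow_natCast] at h2
    refine le_trans ?_ h2
    push_cast
    refine mul_le_mul_of_nonneg_left (Real.exp_le_exp.2 ?_) (by positivity)
    rw [pow_succ] at hl2
    linarith

end Eigendecay

/-! ### Variance bound on the good event. -/

section TruncatedVariance

variable {E : Type*} {W : Set E} {k : E → E → ℝ} {τ : ℝ} {lam : ℕ → ℝ} {ψ : ℕ → E → ℝ} {F : ℝ}

theorem varBar_le_effectiveDim (hk : IsKernelOn k W) (hτ : 0 < τ) (hlam : ∀ j, 0 ≤ lam j)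
    (hsum : ∀ w ∈ W, ∀ w' ∈ W, HasSum (fun j => lam j * ψ j w * ψ j w') (k w w'))
    (hψF : ∀ j w, |ψ j w| ≤ F) {D : ℕ} {ε : ℝ} (hε : HasSum (fun j => lam (j + D)) ε) {T K : ℕ}
    (hT : 0 < T) (hK : 0 < K) {z : Fin (T * K) → E} (hz : ∀ i, z i ∈ W)
    (hgood : ∀ v : Fin D → ℝ, 10 / 27 * ((T * K : ℕ) : ℝ) * (v ⬝ᵥ v) ≤
      ∑ i, v ⬝ᵥ (whitened (fun j : Fin D => T * lam j / (T * lam j + τ)) (fun j => ψ j) (z i) *ᵥ v))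
    {w : E} (hw : w ∈ W) :
    varBar k τ K z w ≤ 27 / 10 * F ^ 2 * effectiveDim (fun j : Fin D => lam j) τ T / T +
      2 * (F ^ 2 * ε) / τ *
        (1 + 27 / 10 * F ^ 2 * effectiveDim (fun j : Fin D => lam j) τ T) := by
  have hT0 : (0 : ℝ) < T := by exact_mod_cast hT
  have hK' : (0 : ℝ) < K := by exact_mod_cast hK
  set dim := effectiveDim (fun j : Fin D => lam j) τ T with hdim
  have hlow := feature_lower_bound_of_whitened (lam := fun j : Fin D => lam j) (fun j => hlam j)
    (ψ := fun j => ψ j) hτ hT0 hK' (ι := Fin (T * K)) (by simp) (z := z) (c := 10 / 27)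
    (by simpa only [Fintype.card_fin] using hgood)
  have hΨ : ∑ j, mercerFeature lam ψ D w j ^ 2 / (T * lam j + τ) ≤ F ^ 2 * dim / T := by
    rw [hdim, effectiveDim, Finset.mul_sum, Finset.sum_div]
    refine Finset.sum_le_sum fun j _ => ?_
    have hl := hlam j
    have hs : ψ j w ^ 2 ≤ F ^ 2 :=
      sq_le_sq' (by linarith [(abs_le.1 (hψF j w)).1]) (abs_le.1 (hψF j w)).2
    have hy : 0 < T * lam j + τ := by positivity
    simp only [mercerFeature]
    rw [mul_pow, Real.sq_sqrt hl]
    calc lam j * ψ j w ^ 2 / (T * lam j + τ) ≤ lam j * F ^ 2 / (T * lam j + τ) := by gcongr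
      _ = F ^ 2 * (T * lam j / (T * lam j + τ)) / T := by field_simp
  have hrem := fun {w w' : E} (hw : w ∈ W) (hw' : w' ∈ W) =>
    abs_remainder_le hlam hsum hψF hε hw hw'
  have hmain := varBar_le_of_feature_lower_bound hτ hK
    (hk.add_smul_one_posDef hz (by positivity)) (hrem hw hw) (fun i => hrem (hz i) hw)
    (fun i j => hrem (hz i) (hz j)) (a := fun j : Fin D => T * lam j + τ)
    (fun j => by have := hlam j; positivity) (by norm_num : (0 : ℝ) < 10 / 27) hlow hΨ
  refine hmain.trans (le_of_eq ?_)
  have hcard : (Fintype.card (Fin (T * K)) : ℝ) / K = T := by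
    rw [Fintype.card_fin]
    push_cast
    field_simp
  have e1 : F ^ 2 * dim / T / (10 / 27) = 27 / 10 * F ^ 2 * dim / T := by ring
  have e2 : (T : ℝ) * (27 / 10 * F ^ 2 * dim / T) = 27 / 10 * F ^ 2 * dim := by field_simp
  rw [hcard, e1, e2]

end TruncatedVariance

/-! ### Random approximating sets. -/

section Sampling

theorem isProbabilityMeasure_samplingLaw {d d' : ℕ} {X : Set (EuclideanSpace ℝ (Fin d))}
    (hX : IsCompact X) (hvol : volume X ≠ 0) (κ : Measure (EuclideanSpace ℝ (Fin d')))
    [IsProbabilityMeasure κ] : IsProbabilityMeasure (samplingLaw X κ) := by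
  have := ProbabilityTheory.cond_isProbabilityMeasure_of_finite hvol hX.measure_lt_top.ne
  unfold samplingLaw
  infer_instance

theorem samplingLaw_compl {d d' : ℕ} {X : Set (EuclideanSpace ℝ (Fin d))}
    {C : Set (EuclideanSpace ℝ (Fin d'))} (hX : IsCompact X) (hvol : volume X ≠ 0)
    (hC : IsCompact C) {κ : Measure (EuclideanSpace ℝ (Fin d'))} [IsProbabilityMeasure κ]
    (hκ : κ Cᶜ = 0) : samplingLaw X κ (X ×ˢ C)ᶜ = 0 := by
  have := isProbabilityMeasure_samplingLaw hX hvol κ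
  have := ProbabilityTheory.cond_isProbabilityMeasure_of_finite hvol hX.measure_lt_top.ne
  rw [prob_compl_eq_zero_iff (hX.measurableSet.prod hC.measurableSet), samplingLaw,
    Measure.prod_prod, (prob_compl_eq_zero_iff hC.measurableSet).1 hκ, mul_one,
    ProbabilityTheory.cond_apply hX.measurableSet, Set.inter_self]
  exact ENNReal.inv_mul_cancel hvol hX.measure_lt_top.ne

variable {E : Type*} [MeasurableSpace E] {W : Set E} {μ : Measure E} [IsProbabilityMeasure μ]

theorem ae_pi_mem (hμ : μ Wᶜ = 0) (N : ℕ) :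
    ∀ᵐ z ∂Measure.pi (fun _ : Fin N => μ), ∀ i, z i ∈ W := by
  rw [ae_all_iff]
  intro i
  exact (measurePreserving_eval (fun _ : Fin N => μ) i).quasiMeasurePreserving.ae
    (measure_eq_zero_iff_ae_notMem.1 hμ |>.mono fun w hw => by simpa using hw)

variable {k : E → E → ℝ} {τ : ℝ} {lam : ℕ → ℝ} {ψ : ℕ → E → ℝ} {Cp βp F : ℝ}

theorem measure_varBar_gt_eq_zero (hμ : μ Wᶜ = 0) (hk : IsKernelOn k W) (hτ : 0 < τ)
    (h0 : ∀ w ∈ W, ∀ w' ∈ W, k w w' = 0) (T K : ℕ) (F : ℝ) :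
    Measure.pi (fun _ : Fin (T * K) => μ) {z | ¬ sSup (varBar k τ K z '' W) ≤
      81 * F ^ 2 * maxInfoGain k W τ T / (13 * T)} = 0 := by
  refine measure_mono_null ?_ (ae_pi_mem hμ (T * K))
  intro z hz hmem
  refine hz (Real.sSup_le ?_ ?_)
  · rintro _ ⟨w, hw, rfl⟩
    have e : (fun i => k (z i) w) = 0 := funext fun i => h0 _ (hmem i) _ hw
    rw [varBar, e, h0 w hw w hw]
    have := hk.maxInfoGain_nonneg hτ T
    simp only [zero_dotProduct, sub_zero, mul_zero]
    positivity
  · have := hk.maxInfoGain_nonneg hτ T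
    positivity

theorem eventually_measure_varBar_gt_le [TopologicalSpace E] (hμ : μ Wᶜ = 0) (hk : IsKernelOn k W)
    (hk1 : ∀ w ∈ W, k w w ≤ 1) (hW : IsCompact W)
    (hcont : ContinuousOn (Function.uncurry k) (W ×ˢ W)) (hτ : 0 < τ)
    (hψ : ∀ j, Measurable (ψ j)) (hF : 0 < F) (hψF : ∀ j w, |ψ j w| ≤ F)
    (horth : ∀ i j, ∫ w, ψ i w * ψ j w ∂μ = if i = j then 1 else 0)
    (hlam : ∀ j, 0 ≤ lam j) (hlam0 : 0 < lam 0)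
    (hsum : ∀ w ∈ W, ∀ w' ∈ W, HasSum (fun j => lam j * ψ j w * ψ j w') (k w w'))
    (hCp : 0 < Cp) (hβp : 1 < βp) (hdecay : PolynomialEigendecay lam Cp βp) {δ : ℝ} (hδ : 0 < δ) :
    ∀ᶠ T : ℕ in Filter.atTop,
      Measure.pi (fun _ : Fin (T * oversampling k W τ T) => μ)
        {z | ¬ sSup (varBar k τ (oversampling k W τ T) z '' W) ≤
          81 * F ^ 2 * maxInfoGain k W τ T / (13 * T)} ≤ ENNReal.ofReal δ := by
  obtain ⟨m₀, a₀, ha₀, hvar₀⟩ := hk.exists_design hτ hW hcont (by norm_num : (0 : ℝ) < 1 / 40)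
  obtain ⟨m, hm⟩ := exists_nat_ge (2 / ((βp - 1) / 2))
  rw [div_le_iff₀ (by linarith)] at hm
  set Z := ∑' j : ℕ, ((j : ℝ) + 1) ^ (-((βp + 1) / 2)) with hZ
  have hZ0 : 0 ≤ Z := tsum_nonneg fun j => by positivity
  set a := (βp + 1) / 2 / βp with ha
  have ha0 : 0 ≤ a := by
    have : 0 < βp := by linarith
    positivity
  have ha1 : a < 1 := by rw [ha, div_lt_one (by linarith)]; linarith
  set A := F ^ 2 * ((Cp / τ) ^ a * Z) + 1 with hA
  have hA0 : 0 < A := by positivity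
  set p₀ := lam 0 / (lam 0 + τ) with hp₀
  have hp₀pos : 0 < p₀ := by positivity
  -- The first threshold pays for the initial design in the information gain bound, the second
  -- absorbs the truncation error into `1/5 F² dim / T`.
  have hlarge := (tendsto_natCast_atTop_atTop (R := ℝ)).eventually_ge_atTop
    (max (50 * (m₀ * (1 + F ^ 2))) (10 * (Cp * Z) * (1 / p₀ + 27 / 10 * F ^ 2) / τ))
  filter_upwards [eventually_exists_dyadic_exponent hA0 ha1 hδ m, hlarge,
    Filter.eventually_ge_atTop 1] with T hdy hTl hT1
  obtain ⟨l, hl1, hl2⟩ := hdy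
  have hT' : (1 : ℝ) ≤ T := by exact_mod_cast hT1
  have hT0 : (0 : ℝ) < T := by linarith
  obtain ⟨ε, hε, hεle⟩ := hdecay.exists_tail_le hlam hCp hβp hm hT1
  set D := T ^ m with hD
  have hD0 : 0 < D := by positivity
  let lamD : Fin D → ℝ := fun j => lam j
  let ψD : Fin D → E → ℝ := fun j => ψ j
  set dim := effectiveDim lamD τ T with hdim
  have hint : ∀ i j, Integrable (fun w => ψ i w * ψ j w) μ := by
    intro i j
    refine Integrable.of_bound ((hψ i).mul (hψ j)).aestronglyMeasurable (F * F)
      (ae_of_all _ fun w => ?_)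
    rw [Real.norm_eq_abs, abs_mul]
    exact mul_le_mul (hψF i w) (hψF j w) (abs_nonneg _) hF.le
  have horthD : ∀ i j : Fin D, ∫ w, ψD i w * ψD j w ∂μ = if i = j then 1 else 0 := by
    intro i j
    simp only [ψD, horth, Fin.ext_iff]
  have hγ : 19 / 40 * dim ≤ maxInfoGain k W τ T :=
    effectiveDim_le_maxInfoGain (lam := lamD) (ψ := ψD) hμ (fun j => hlam j) (fun i j => hint i j) horthD
      (fun j w => hψF j w) hk hk1 (isKernelOn_remainder hk hlam hsum D) hτ ha₀ hvar₀ hT1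
      ((le_max_left _ _).trans hTl)
  have hdimle : dim ≤ (Cp / τ) ^ a * Z * (T : ℝ) ^ a := hdecay.effectiveDim_le hlam hCp hβp hτ hT0 D
  -- A lower bound on `dim` that does not depend on `T` is what lets an error of order `T ^ (-2)` be
  -- compared with `dim / T`; this uses `0 < lam 0`.
  have hdimge : p₀ ≤ dim := by
    have h1 : T * lam 0 / (T * lam 0 + τ) ≤ dim :=
      Finset.single_le_sum (f := fun j : Fin D => T * lamD j / (T * lamD j + τ))
        (fun j _ => by have := hlam j; simp only [lamD]; positivity)
        (Finset.mem_univ (⟨0, hD0⟩ : Fin D))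
    refine le_trans ?_ h1
    rw [hp₀, div_le_div_iff₀ (by positivity) (by positivity)]
    nlinarith [mul_pos hlam0 hτ]
  have hdim0 : 0 < dim := lt_of_lt_of_le hp₀pos hdimge
  have hγ0 : 0 < maxInfoGain k W τ T := lt_of_lt_of_le (by positivity) hγ
  set K := oversampling k W τ T with hKdef
  have hK : 0 < K := Nat.ceil_pos.2 (by positivity)
  have hK' : (0 : ℝ) < K := by exact_mod_cast hK
  let p : Fin D → ℝ := fun j => T * lamD j / (T * lamD j + τ)
  have hp0 : ∀ j, 0 ≤ p j := fun j => by have := hlam j; simp only [p, lamD]; positivity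
  have hp1 : ∀ j, p j ≤ 1 := fun j => by
    have := hlam j
    exact (div_le_one (by simp only [lamD]; positivity)).2 (by linarith)
  have hR : F ^ 2 * dim + 1 ≤ A * (T : ℝ) ^ a := by
    have h1 : 1 ≤ (T : ℝ) ^ a := Real.one_le_rpow hT' ha0
    calc F ^ 2 * dim + 1 ≤ F ^ 2 * ((Cp / τ) ^ a * Z * (T : ℝ) ^ a) + (T : ℝ) ^ a := by gcongr
      _ = _ := by rw [hA]; ring
  have hTK : (T : ℝ) ≤ ((T * K : ℕ) : ℝ) := by
    exact_mod_cast Nat.le_mul_of_pos_right T hK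
  have hl : 2 ^ l * (F ^ 2 * dim + 1) * 36 ≤ ((T * K : ℕ) : ℝ) := by
    refine le_trans ?_ (hl1.trans hTK)
    gcongr
  have hW' := integral_whitened (μ := μ) hp0 (ψ := ψD) (fun j => hψ j) (fun j w => hψF j w) horthD
  have hprob := measure_exists_sum_lt_le (μ := μ) (X := whitened p ψD) (fun i j => (hW' i j).1)
    (fun i j => (hW' i j).2.1) (fun i j => (hW' i j).2.2) (fun w => whitened_posSemidef hp1 ψD w)
    (R := F ^ 2 * dim + 1) (by positivity)
    (fun w v => dotProduct_whitened_mulVec_le hp0 (fun j => hψF j w) v) l (T * K)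
    (Nat.mul_pos hT1 hK) hl
  have hfinal := hprob.trans (ENNReal.ofReal_le_ofReal (by simpa using hl2))
  refine le_trans (measure_mono_ae ?_) hfinal
  filter_upwards [ae_pi_mem hμ (T * K)] with z hz hbad hgood
  refine hbad (Real.sSup_le ?_ (by positivity))
  rintro _ ⟨w, hw, rfl⟩
  refine (varBar_le_effectiveDim hk hτ hlam hsum hψF hε hT1 hK hz hgood hw).trans ?_
  have hsmall : 2 * (F ^ 2 * ε) / τ * (1 + 27 / 10 * F ^ 2 * dim) ≤ 1 / 5 * F ^ 2 * dim / T := by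
    have h1 : 1 ≤ dim / p₀ := (one_le_div hp₀pos).2 hdimge
    have h2 : 10 * (Cp * Z) * (1 / p₀ + 27 / 10 * F ^ 2) / τ ≤ T := (le_max_right _ _).trans hTl
    calc 2 * (F ^ 2 * ε) / τ * (1 + 27 / 10 * F ^ 2 * dim)
        ≤ 2 * (F ^ 2 * (Cp * Z / T ^ 2)) / τ * (dim / p₀ + 27 / 10 * F ^ 2 * dim) := by
          gcongr
      _ = (1 / 5 * F ^ 2 * dim / T ^ 2) * (10 * (Cp * Z) * (1 / p₀ + 27 / 10 * F ^ 2) / τ) := by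
          field_simp
          ring
      _ ≤ (1 / 5 * F ^ 2 * dim / T ^ 2) * T := by gcongr
      _ = _ := by field_simp
  calc 27 / 10 * F ^ 2 * dim / T + 2 * (F ^ 2 * ε) / τ * (1 + 27 / 10 * F ^ 2 * dim)
      ≤ 27 / 10 * F ^ 2 * dim / T + 1 / 5 * F ^ 2 * dim / T := by linarith
    _ = F ^ 2 / T * (29 / 10 * dim) := by ring
    -- By `hγ`, `dim ≤ 40/19 γ_T`, and `29/10 * 40/19 = 116/19 < 81/13`.
    _ ≤ F ^ 2 / T * (81 / 13 * maxInfoGain k W τ T) := by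
        gcongr ?_ * ?_
        linarith
    _ = _ := by field_simp

end Sampling

end USCA

/-! ### The main theorem. -/

theorem mainTheorem4 {d d' : ℕ}
    (X : Set (EuclideanSpace ℝ (Fin d))) (C : Set (EuclideanSpace ℝ (Fin d')))
    (hXcompact : IsCompact X) (hXconvex : Convex ℝ X) (hXvol : volume X ≠ 0)
    (hCcompact : IsCompact C) (hCconvex : Convex ℝ C)
    (κ : Measure (EuclideanSpace ℝ (Fin d'))) [IsProbabilityMeasure κ] (hκ : κ Cᶜ = 0)
    (k : USCA.Pt d d' → USCA.Pt d d' → ℝ)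
    (hk : USCA.IsKernelOn k (X ×ˢ C))
    (hkcont : ContinuousOn (Function.uncurry k) ((X ×ˢ C) ×ˢ (X ×ˢ C)))
    (hk1 : ∀ w ∈ X ×ˢ C, k w w ≤ 1)
    (τ : ℝ) (hτ : 0 < τ)
    (lam : ℕ → ℝ) (ψ : ℕ → USCA.Pt d d' → ℝ)
    (hMercer : USCA.IsMercerSystem k (X ×ˢ C) (USCA.samplingLaw X κ) lam ψ)
    (Cp βp F : ℝ) (hCp : 0 < Cp) (hβp : 1 < βp) (hF : 0 < F)
    (hdecay : USCA.PolynomialEigendecay lam Cp βp)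
    (hbound : ∀ j, ∀ w ∈ X ×ˢ C, |ψ j w| ≤ F) :
    (∀ (B : ℝ), 0 < B → ∀ (T : ℕ) (t : Fin T) (x : Fin T → EuclideanSpace ℝ (Fin d)),
      (∀ i, x i ∈ X) →
      ∀ z : Fin (T * USCA.oversampling k (X ×ˢ C) τ T) → USCA.Pt d d', (∀ i, z i ∈ X ×ˢ C) →
        BddAbove (USCA.varBar k τ (USCA.oversampling k (X ×ˢ C) τ T) z '' (X ×ˢ C)) ∧
        BddAbove (USCA.sensitivityValues k X C τ B t x (USCA.oversampling k (X ×ˢ C) τ T) z) ∧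
        sSup (USCA.sensitivityValues k X C τ B t x (USCA.oversampling k (X ×ˢ C) τ T) z) ≤
          2 * B * sSup (USCA.varBar k τ (USCA.oversampling k (X ×ˢ C) τ T) z '' (X ×ˢ C))) ∧
    (∃ Nbar : ℝ → ℝ, ∀ δ : ℝ, 0 < δ → δ < 1 → ∀ T : ℕ,
      max (USCA.Nbar₁ Cp βp F (δ / 4)) (Nbar (δ / 4)) < (T : ℝ) →
        Measure.pi (fun _ : Fin (T * USCA.oversampling k (X ×ˢ C) τ T) => USCA.samplingLaw X κ)
          {z | ¬ sSup (USCA.varBar k τ (USCA.oversampling k (X ×ˢ C) τ T) z '' (X ×ˢ C)) ≤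
            81 * F ^ 2 * USCA.maxInfoGain k (X ×ˢ C) τ T / (13 * T)} ≤ ENNReal.ofReal δ) := by
  refine ⟨fun B hB T t x hx z hz => USCA.sensitivity_bound hk hk1 hτ hB t hx hz, ?_⟩
  have hprob := USCA.isProbabilityMeasure_samplingLaw hXcompact hXvol κ
  have hμ := USCA.samplingLaw_compl hXcompact hXvol hCcompact hκ
  set W := X ×ˢ C with hW
  set μ := USCA.samplingLaw X κ
  have hWc : IsCompact W := hXcompact.prod hCcompact
  -- If the top eigenvalue vanishes, so does the kernel on `W`, and the variance is zero almost
  -- surely.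
  rcases (hMercer.nonneg 0).eq_or_lt with h0 | h0
  · have hlam : ∀ j, lam j = 0 := fun j =>
      le_antisymm ((hMercer.antitone (Nat.zero_le j)).trans h0.symm.le) (hMercer.nonneg j)
    have hk0 : ∀ w ∈ W, ∀ w' ∈ W, k w w' = 0 := fun w hw w' hw' =>
      (hMercer.hasSum w hw w' hw').unique (by simp [hlam])
    refine ⟨fun _ => 0, fun δ _ _ T _ => ?_⟩
    rw [USCA.measure_varBar_gt_eq_zero hμ hk hτ hk0]
    exact zero_le
  -- Extension by zero makes the eigenfunctions measurable and bounded on the whole space; nothing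
  -- changes on `W`, which carries `μ`.
  · let ψ' : ℕ → USCA.Pt d d' → ℝ := fun j => W.indicator (ψ j)
    have hψ'W : ∀ j, ∀ w ∈ W, ψ' j w = ψ j w := fun j w hw => Set.indicator_of_mem hw _
    have hmeas : ∀ j, Measurable (ψ' j) := by
      classical
      intro j
      have := (hMercer.continuousOn j).measurable_piecewise
        (continuousOn_const (c := (0 : ℝ)) (s := Wᶜ)) hWc.measurableSet
      have e : ψ' j = W.piecewise (ψ j) fun _ => 0 := Set.piecewise_eq_indicator.symm
      rwa [e]
    have hb : ∀ j w, |ψ' j w| ≤ F := by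
      intro j w
      by_cases hw : w ∈ W
      · rw [hψ'W j w hw]
        exact hbound j w hw
      · simp [ψ', hw, hF.le]
    have horth : ∀ i j, ∫ w, ψ' i w * ψ' j w ∂μ = if i = j then 1 else 0 := by
      intro i j
      rw [← hMercer.orthonormal i j]
      refine integral_congr_ae ?_
      filter_upwards [measure_eq_zero_iff_ae_notMem.1 hμ] with w hw
      have hw : w ∈ W := by simpa using hw
      rw [hψ'W i w hw, hψ'W j w hw]
    have hsum : ∀ w ∈ W, ∀ w' ∈ W, HasSum (fun j => lam j * ψ' j w * ψ' j w') (k w w') := by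
      intro w hw w' hw'
      simpa only [hψ'W _ w hw, hψ'W _ w' hw'] using hMercer.hasSum w hw w' hw'
    -- The threshold is evaluated at `δ / 4` in the claim, hence the probability `4 * δ` here. For
    -- `δ ≤ 0` its value is irrelevant.
    have hex : ∀ δ : ℝ, ∃ N : ℕ, 0 < δ → ∀ T : ℕ, N ≤ T →
        Measure.pi (fun _ : Fin (T * USCA.oversampling k W τ T) => μ)
          {z | ¬ sSup (USCA.varBar k τ (USCA.oversampling k W τ T) z '' W) ≤
            81 * F ^ 2 * USCA.maxInfoGain k W τ T / (13 * T)} ≤ ENNReal.ofReal (4 * δ) := by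
      intro δ
      by_cases hδ : 0 < δ
      · obtain ⟨N, hN⟩ := Filter.eventually_atTop.1 (USCA.eventually_measure_varBar_gt_le hμ hk hk1
          hWc hkcont hτ hmeas hF hb horth hMercer.nonneg h0 hsum hCp hβp hdecay
          (δ := 4 * δ) (by positivity))
        exact ⟨N, fun _ => hN⟩
      · exact ⟨0, fun h => absurd h hδ⟩
    choose N hN using hex
    refine ⟨fun δ => N δ, fun δ hδ _ T hT => ?_⟩
    have hT' : (N (δ / 4) : ℝ) ≤ T := ((le_max_right _ _).trans_lt hT).le
    have h := hN (δ / 4) (by positivity) T (by exact_mod_cast hT')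
    rwa [mul_div_cancel₀ δ (by norm_num : (4 : ℝ) ≠ 0)] at h

end
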